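/- Let $\alpha\in(0,1)$ and $\mu_\alpha(du)=\frac{\alpha}{\Gamma(1-\alpha)}u^{-\alpha-1}\,du$ on $(0,\infty)$. Let $N=\sum_i\delta_{(T_i,P_i)}$ be a Poisson point process on $(0,\infty)^2$ with intensity $\mathrm{Leb}\times\mu_\alpha$, let $\tau_t=\sum_{T_i\le t}P_i$ be the corresponding $\alpha$-stable subordinator, and put $L_s=\inf\{t\ge 0:\tau_t>s\}$, $g_s=\tau(L_s-)$, $d_s=\tau(L_s)$, $A_s=s-g_s$, $B_s=d_s-s$, $\Delta_s=A_s+B_s$. Let $\boldsymbol e\sim\mathrm{Exp}(1)$ be independent of $N$. Further, on a possibly different probability space, let $G_1\sim\mathrm{gamma}(1-\alpha,1)$, $U\sim\mathrm U(0,1)$, $T_1^\wedge\sim\mathrm{Exp}(1)$ and a Poisson point process $N^\vee=\sum_i\delta_{(T_i^\vee,P_i^\vee)}$ on $(0,\infty)^2$ with intensity $\mathrm{Leb}\times e^{-u}\mu_\alpha(du)$ be independent. Then, almost surely, $\tau_t<\infty$ for all $t$ and $\tau_t\to\infty$ as $t\to\infty$; the sum $G_0=\sum_{T_i^\vee\le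 T_1^\wedge}P_i^\vee$ is almost surely finite and has the $\mathrm{gamma}(\alpha,1)$ law; and, with $\Gamma=G_0+G_1$, $$(\boldsymbol e,L_{\boldsymbol e},B_{\boldsymbol e},A_{\boldsymbol e},g_{\boldsymbol e},d_{\boldsymbol e},\Delta_{\boldsymbol e})\stackrel{d}{=}\bigl(\Gamma,\;T_1^\wedge,\;G_1(U^{-1/\alpha}-1),\;G_1,\;G_0,\;G_0+G_1U^{-1/\alpha},\;G_1U^{-1/\alpha}\bigr).$$ -/

import Mathlib

open MeasureTheory ProbabilityTheory
open scoped ENNReal NNReal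

noncomputable section

/-- A counting measure: a countable (possibly finite or empty) sum of unit point masses. -/
def IsCountingMeasure {E : Type*} [MeasurableSpace E] (m : Measure E) : Prop :=
  ∃ (I : Set ℕ) (x : ℕ → E), m = Measure.sum fun i : I => Measure.dirac (x i)

/-- The Poisson law with parameter `r ∈ [0, ∞]`, as a law on `[0, ∞]`; for `r = ∞` it is the point
mass at `∞`. -/
def poissonLaw (r : ℝ≥0∞) : Measure ℝ≥0∞ :=
  if r = ∞ then Measure.dirac ∞ else (poissonMeasure r.toNNReal).map fun n : ℕ => (n : ℝ≥0∞)

/-- `N ∼ PPP(ν)`: the point process `N` is, under `P`, a Poisson point process with intensity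
measure `ν`. -/
structure IsPoissonPointProcess {Ω E : Type*} [MeasurableSpace Ω] [MeasurableSpace E]
    (N : Ω → Measure E) (ν : Measure E) (P : Measure Ω) : Prop where
  measurable : Measurable N
  counting : ∀ ω, IsCountingMeasure (N ω)
  law_apply : ∀ B : Set E, MeasurableSet B → P.map (fun ω => N ω B) = poissonLaw (ν B)
  indep : ∀ (n : ℕ) (B : Fin n → Set E), (∀ i, MeasurableSet (B i)) →
    Pairwise (fun i j => Disjoint (B i) (B j)) → iIndepFun (fun i ω => N ω (B i)) P

/-- The Lévy measure `μ_α(du) = α / Γ(1 - α) · u^{-(α + 1)} du` on `(0, ∞)`. -/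
def stableLevy (α : ℝ) : Measure ℝ :=
  (volume.restrict (Set.Ioi 0)).withDensity
    fun u => ENNReal.ofReal (α / Real.Gamma (1 - α) * u ^ (-(α + 1)))

/-- The measure `ν^∨(du) = e^{-u} μ_α(du)` on `(0, ∞)`. -/
def thinnedLevy (α : ℝ) : Measure ℝ :=
  (stableLevy α).withDensity fun u => ENNReal.ofReal (Real.exp (-u))

/-- The product of Lebesgue measure on `(0, ∞)` (time) and a measure `μ` (jump sizes). -/
def timeJumpIntensity (μ : Measure ℝ) : Measure (ℝ × ℝ) :=
  (volume.restrict (Set.Ioi (0 : ℝ))).prod μ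

/-- For points `(T_i, P_i)` forming the counting measure `m`, this is
`τ_t = ∑_{T_i ≤ t} P_i = ∫ x 1{s ≤ t} m(ds, dx)`, with value in `[0, ∞]`. -/
def jumpSum (m : Measure (ℝ × ℝ)) (t : ℝ) : ℝ≥0∞ :=
  ∫⁻ p in {p : ℝ × ℝ | p.1 ≤ t}, ENNReal.ofReal p.2 ∂m

/-- The right continuous inverse `L_s = inf {t ≥ 0 : τ_t > s}`. -/
def inverseTime (m : Measure (ℝ × ℝ)) (s : ℝ) : ℝ :=
  sInf {t : ℝ | 0 ≤ t ∧ ENNReal.ofReal s < jumpSum m t}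

/-- The left end point `g_s = τ(L_s -)`, a left limit of `τ`. -/
def leftEnd (m : Measure (ℝ × ℝ)) (s : ℝ) : ℝ :=
  (Function.leftLim (jumpSum m) (inverseTime m s)).toReal

/-- The right end point `d_s = τ(L_s)`. -/
def rightEnd (m : Measure (ℝ × ℝ)) (s : ℝ) : ℝ :=
  (jumpSum m (inverseTime m s)).toReal

/-- The undershoot `A_s = s - τ(L_s -)`. -/
def undershoot (m : Measure (ℝ × ℝ)) (s : ℝ) : ℝ := s - leftEnd m s

/-- The overshoot `B_s = τ(L_s) - s`. -/
def overshoot (m : Measure (ℝ × ℝ)) (s : ℝ) : ℝ := rightEnd m s - s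

/-- The length `Δ_s = A_s + B_s` of the jump straddling `s`. -/
def straddlingLength (m : Measure (ℝ × ℝ)) (s : ℝ) : ℝ := undershoot m s + overshoot m s

end

/-! All seven coordinates are linear functions of four: $(L,g,A,\Delta)$ at the level $e$ on one
side, $(T,G_0,G_1,G_1U^{-1/\alpha})$ on the other. These are almost surely nonnegative, so equality
of their Laplace transforms at integer points suffices (`identDistrib_of_laplace`, by
Stone–Weierstrass for polynomials in the $e^{-x_i}$).

For a subordinator with Laplace exponent $\psi$, cut time into steps of length $\delta=2^{-n}$ and
split according to the step $j$ in which the path crosses $e$. Integrating out $e$ and using the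
Laplace functional of the Poisson process, the contribution of step $j$ is a fixed factor times the
$j$-th power of $e^{-\delta(q+\psi(1+l))}$. Summing the geometric series and letting $\delta\to0$
gives $$\frac{1}{q+\psi(1+l)}\cdot\frac{\psi(1+r+k)-\psi(k)}{1+r}$$ (`integral_exp_neg_straddling`).
The product form shows that $(L,g)$ and $(A,\Delta)$ are independent.

Take $\psi(x)=x^\alpha$. The tempered measure has exponent $(1+l)^\alpha-1$, so evaluating its
subordinator at an independent exponential time $T$ gives $1/(q+(1+l)^\alpha)$ for $(T,G_0)$
(`integral_exp_neg_time_mul`). The second factor is the transform of $(G_1,G_1U^{-1/\alpha})$: a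
gamma transform given $U$, then an elementary integral over $U$ (`integral_exp_neg_gamma_uniform`).
The gamma law of $G_0$ is the case $q=r=k=0$. -/

open scoped BoundedContinuousFunction

/-! ### The Laplace kernel on `[0, ∞]` -/

/-- The map `x ↦ e^{-x}` on `[0, ∞]`, with value `0` at `∞`. -/
noncomputable def expNeg (x : ℝ≥0∞) : ℝ := if x = ∞ then 0 else Real.exp (-x.toReal)

@[simp] lemma expNeg_top : expNeg ∞ = 0 := if_pos rfl

lemma expNeg_of_ne_top {x : ℝ≥0∞} (hx : x ≠ ∞) : expNeg x = Real.exp (-x.toReal) := if_neg hx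

lemma expNeg_ofReal {x : ℝ} (hx : 0 ≤ x) : expNeg (ENNReal.ofReal x) = Real.exp (-x) := by
  rw [expNeg_of_ne_top ENNReal.ofReal_ne_top, ENNReal.toReal_ofReal hx]

@[simp] lemma expNeg_zero : expNeg 0 = 1 := by simp [expNeg]

lemma expNeg_nonneg (x : ℝ≥0∞) : 0 ≤ expNeg x := by
  unfold expNeg; split_ifs <;> positivity

lemma expNeg_le_one (x : ℝ≥0∞) : expNeg x ≤ 1 := by
  unfold expNeg; split_ifs
  · exact zero_le_one
  · simp

lemma norm_expNeg_le_one (x : ℝ≥0∞) : ‖expNeg x‖ ≤ 1 := by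
  rw [Real.norm_of_nonneg (expNeg_nonneg x)]; exact expNeg_le_one x

lemma expNeg_eq_one_iff {x : ℝ≥0∞} : expNeg x = 1 ↔ x = 0 := by
  refine ⟨fun h => ?_, fun h => by simp [h]⟩
  unfold expNeg at h
  split_ifs at h with hx
  · simp at h
  · simp only [Real.exp_eq_one_iff, neg_eq_zero, ENNReal.toReal_eq_zero_iff, hx, or_false] at h
    exact h

lemma expNeg_eq_zero_iff {x : ℝ≥0∞} : expNeg x = 0 ↔ x = ∞ := by
  simp [expNeg, Real.exp_ne_zero]

lemma expNeg_add (x y : ℝ≥0∞) : expNeg (x + y) = expNeg x * expNeg y := by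
  by_cases hx : x = ∞
  · simp [hx]
  by_cases hy : y = ∞
  · simp [hy]
  rw [expNeg_of_ne_top hx, expNeg_of_ne_top hy, expNeg_of_ne_top (ENNReal.add_ne_top.2 ⟨hx, hy⟩),
    ENNReal.toReal_add hx hy, neg_add, Real.exp_add]

lemma expNeg_sum {ι : Type*} (s : Finset ι) (f : ι → ℝ≥0∞) :
    expNeg (∑ i ∈ s, f i) = ∏ i ∈ s, expNeg (f i) := by
  classical
  induction s using Finset.induction_on with
  | empty => simp
  | insert a s ha ih => rw [Finset.sum_insert ha, Finset.prod_insert ha, expNeg_add, ih]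

lemma expNeg_antitone : Antitone expNeg := by
  intro x y h
  by_cases hy : y = ∞
  · simp [hy, expNeg_nonneg]
  have hx : x ≠ ∞ := ne_top_of_le_ne_top hy h
  rw [expNeg_of_ne_top hx, expNeg_of_ne_top hy]
  exact Real.exp_le_exp.2 (neg_le_neg (ENNReal.toReal_mono hy h))

lemma expNeg_eq_toReal (x : ℝ≥0∞) : expNeg x = (EReal.exp (-(x : EReal))).toReal := by
  induction x with
  | top => simp
  | coe x =>
    rw [expNeg_of_ne_top ENNReal.coe_ne_top]
    have : (-(((x : ℝ≥0∞)) : EReal)) = ((-(x : ℝ) : ℝ) : EReal) := rfl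
    rw [this, EReal.exp_coe, ENNReal.toReal_ofReal (Real.exp_nonneg _)]
    rfl

lemma continuous_expNeg : Continuous expNeg := by
  have h : Continuous fun x : ℝ≥0∞ => EReal.exp (-(x : EReal)) :=
    ENNReal.continuous_exp.comp (continuous_neg.comp continuous_coe_ennreal_ereal)
  have h' : ∀ x : ℝ≥0∞, EReal.exp (-(x : EReal)) ≠ ∞ := by
    intro x hx
    rw [EReal.exp_eq_top_iff, EReal.neg_eq_top_iff] at hx
    exact absurd hx (by simp)
  have : expNeg = fun x : ℝ≥0∞ => (EReal.exp (-(x : EReal))).toReal := funext expNeg_eq_toReal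
  rw [this, continuous_iff_continuousAt]
  exact fun x => (ENNReal.tendsto_toReal (h' x)).comp (h.tendsto x)

lemma measurable_expNeg : Measurable expNeg := continuous_expNeg.measurable

lemma expNeg_mul_natCast (c : ℝ≥0∞) (n : ℕ) : expNeg (c * n) = expNeg c ^ n := by
  induction n with
  | zero => simp
  | succ n ih => rw [Nat.cast_succ, mul_add, mul_one, expNeg_add, ih, pow_succ]

/-! ### Laplace functional of a Poisson point process -/

/-- The Laplace transform of the Poisson law. -/
lemma integral_expNeg_mul_poissonLaw (c r : ℝ≥0∞) :
    ∫ x, expNeg (c * x) ∂(poissonLaw r) = expNeg (ENNReal.ofReal (1 - expNeg c) * r) := by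
  have hm : Measurable fun x : ℝ≥0∞ => expNeg (c * x) := measurable_expNeg.comp (by fun_prop)
  unfold poissonLaw
  split_ifs with hr
  · rw [integral_dirac, hr]
    -- Here the count is infinite: for `c ≠ 0` both sides are `0`, and for `c = 0` the convention `0
    -- * ∞ = 0` makes both `1`.
    by_cases hc : c = 0
    · simp [hc]
    · have : ENNReal.ofReal (1 - expNeg c) ≠ 0 := by
        rw [Ne, ENNReal.ofReal_eq_zero, not_le, sub_pos]
        exact lt_of_le_of_ne (expNeg_le_one c) (fun h => hc (expNeg_eq_one_iff.1 h))
      rw [ENNReal.mul_top hc, ENNReal.mul_top this]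
  · rw [integral_map (by fun_prop) hm.aestronglyMeasurable, integral_poissonMeasure]
    simp only [expNeg_mul_natCast, smul_eq_mul]
    lift r to ℝ≥0 using hr
    have hsum : ∀ n : ℕ, Real.exp (-((r : ℝ≥0∞).toNNReal : ℝ)) * (((r : ℝ≥0∞).toNNReal : ℝ)) ^ n /
        (n.factorial : ℝ) * expNeg c ^ n =
        Real.exp (-(r : ℝ)) * (((r : ℝ) * expNeg c) ^ n / (n.factorial : ℝ)) := by
      intro n; simp only [ENNReal.toNNReal_coe, mul_pow]; ring
    rw [tsum_congr hsum, tsum_mul_left, ← congrFun (NormedSpace.exp_eq_tsum_div (𝔸 := ℝ)) _,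
      ← Real.exp_eq_exp_ℝ, ← Real.exp_add]
    rw [← ENNReal.ofReal_coe_nnreal, ← ENNReal.ofReal_mul (sub_nonneg.2 (expNeg_le_one c)),
      expNeg_ofReal (mul_nonneg (sub_nonneg.2 (expNeg_le_one c)) r.coe_nonneg)]
    congr 1; ring

namespace IsPoissonPointProcess

variable {Ω E : Type*} [MeasurableSpace Ω] [MeasurableSpace E]
  {N : Ω → Measure E} {ν : Measure E} {P : Measure Ω}

lemma measurable_apply (hN : IsPoissonPointProcess N ν P) {B : Set E} (hB : MeasurableSet B) :
    Measurable fun ω => N ω B := (Measure.measurable_coe hB).comp hN.measurable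

lemma measurable_lintegral (hN : IsPoissonPointProcess N ν P) {f : E → ℝ≥0∞} (hf : Measurable f) :
    Measurable fun ω => ∫⁻ x, f x ∂(N ω) := (Measure.measurable_lintegral hf).comp hN.measurable

lemma integral_expNeg_mul_apply (hN : IsPoissonPointProcess N ν P) (c : ℝ≥0∞) {B : Set E}
    (hB : MeasurableSet B) :
    ∫ ω, expNeg (c * N ω B) ∂P = expNeg (ENNReal.ofReal (1 - expNeg c) * ν B) := by
  have hm : Measurable fun x : ℝ≥0∞ => expNeg (c * x) := measurable_expNeg.comp (by fun_prop)
  rw [← integral_expNeg_mul_poissonLaw, ← hN.law_apply B hB,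
    integral_map (hN.measurable_apply hB).aemeasurable hm.aestronglyMeasurable]

/-- The finitely many level sets of `f` are disjoint, so the counts on them are independent and the
expectation factorises into Poisson transforms. The range is enumerated by `Fin` to match the form
of the independence axiom. -/
lemma integral_expNeg_simpleFunc (hN : IsPoissonPointProcess N ν P) (f : SimpleFunc E ℝ≥0∞) :
    ∫ ω, expNeg (∫⁻ x, f x ∂(N ω)) ∂P =
      expNeg (∫⁻ x, ENNReal.ofReal (1 - expNeg (f x)) ∂ν) := by
  classical
  have hm : ∀ c : ℝ≥0∞, Measurable fun x : ℝ≥0∞ => expNeg (c * x) :=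
    fun c => measurable_expNeg.comp (by fun_prop)
  let en := f.range.equivFin
  let c : Fin f.range.card → ℝ≥0∞ := fun i => (en.symm i : ℝ≥0∞)
  have hsum : ∀ g : ℝ≥0∞ → ℝ≥0∞, ∑ y ∈ f.range, g y = ∑ i, g (c i) := fun g => by
    rw [← Finset.sum_coe_sort f.range g]
    exact (Equiv.sum_comp en.symm fun y => g (y : ℝ≥0∞)).symm
  have hint : ∀ ω, expNeg (∫⁻ x, f x ∂(N ω)) = ∏ i, expNeg (c i * N ω (f ⁻¹' {c i})) := by
    intro ω
    rw [SimpleFunc.lintegral_eq_lintegral, SimpleFunc.lintegral,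
      hsum fun y => y * N ω (f ⁻¹' {y}), expNeg_sum]
  have hB : ∀ i, MeasurableSet (f ⁻¹' {c i}) := fun i => f.measurableSet_fiber _
  have hdisj : Pairwise fun i j => Disjoint (f ⁻¹' {c i}) (f ⁻¹' {c j}) := by
    intro i j hij
    refine Disjoint.preimage _ (Set.disjoint_singleton.2 fun h => hij ?_)
    exact en.symm.injective (Subtype.ext h)
  have hind := hN.indep _ (fun i => f ⁻¹' {c i}) hB hdisj
  simp_rw [hint]
  rw [hind.integral_fun_prod_comp (f := fun i x => expNeg (c i * x))
    (fun i => (hN.measurable_apply (hB i)).aemeasurable) fun i => (hm _).aestronglyMeasurable]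
  simp_rw [hN.integral_expNeg_mul_apply _ (hB _)]
  rw [← expNeg_sum]
  congr 1
  have : (fun x => ENNReal.ofReal (1 - expNeg (f x))) =
      (f.map fun y => ENNReal.ofReal (1 - expNeg y)) := rfl
  rw [this, SimpleFunc.lintegral_eq_lintegral, SimpleFunc.map_lintegral,
    hsum fun y => ENNReal.ofReal (1 - expNeg y) * ν (f ⁻¹' {y})]

/-- The Laplace functional of a Poisson point process. -/
lemma integral_expNeg [IsFiniteMeasure P] (hN : IsPoissonPointProcess N ν P) {f : E → ℝ≥0∞}
    (hf : Measurable f) :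
    ∫ ω, expNeg (∫⁻ x, f x ∂(N ω)) ∂P =
      expNeg (∫⁻ x, ENNReal.ofReal (1 - expNeg (f x)) ∂ν) := by
  -- Simple functions increase to `f`: monotone convergence applies inside both exponentials,
  -- dominated convergence to the outer expectation.
  have hmono : ∀ x, Monotone fun n => SimpleFunc.eapprox f n x :=
    fun x => fun _ _ h => SimpleFunc.monotone_eapprox f h x
  have hlim : ∀ x, Filter.Tendsto (fun n => SimpleFunc.eapprox f n x) Filter.atTop
      (nhds (f x)) := SimpleFunc.tendsto_eapprox hf
  have h1 : Filter.Tendsto (fun n => ∫ ω, expNeg (∫⁻ x, SimpleFunc.eapprox f n x ∂(N ω)) ∂P)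
      Filter.atTop (nhds (∫ ω, expNeg (∫⁻ x, f x ∂(N ω)) ∂P)) := by
    refine tendsto_integral_of_dominated_convergence (fun _ => 1) (fun n => ?_)
      (integrable_const _) (fun n => ae_of_all _ fun ω => norm_expNeg_le_one _)
      (ae_of_all _ fun ω => ?_)
    · exact (measurable_expNeg.comp
        (hN.measurable_lintegral (SimpleFunc.measurable _))).aestronglyMeasurable
    · refine (continuous_expNeg.tendsto _).comp ?_
      exact lintegral_tendsto_of_tendsto_of_monotone (fun n => (SimpleFunc.measurable _).aemeasurable)
        (ae_of_all _ hmono) (ae_of_all _ hlim)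
  simp_rw [hN.integral_expNeg_simpleFunc] at h1
  refine tendsto_nhds_unique h1 ((continuous_expNeg.tendsto _).comp ?_)
  refine lintegral_tendsto_of_tendsto_of_monotone (fun n => ?_) (ae_of_all _ fun x => ?_)
    (ae_of_all _ fun x => ?_)
  · exact (((measurable_expNeg.comp (SimpleFunc.measurable _)).const_sub
      1).ennreal_ofReal).aemeasurable
  · intro m n hmn
    exact ENNReal.ofReal_le_ofReal (sub_le_sub_left (expNeg_antitone (hmono x hmn)) _)
  · exact (ENNReal.continuous_ofReal.tendsto _).comp
      (((continuous_expNeg.tendsto _).comp (hlim x)).const_sub 1)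

end IsPoissonPointProcess

/-! ### Integer Laplace transforms determine laws on the orthant -/

/-- The polynomials in the functions `x ↦ e^{-x_i}`, as an algebra of bounded continuous functions
on the orthant. -/
noncomputable def expPolynomials (ι : Type*) [Fintype ι] : StarSubalgebra ℝ ((ι → ℝ≥0) →ᵇ ℝ) where
  carrier := {g | ∃ p : MvPolynomial ι ℝ, ∀ x, g x = p.eval fun i => Real.exp (-(x i : ℝ))}
  mul_mem' := by
    rintro f g ⟨p, hp⟩ ⟨q, hq⟩
    exact ⟨p * q, fun x => by simp [hp, hq]⟩
  add_mem' := by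
    rintro f g ⟨p, hp⟩ ⟨q, hq⟩
    exact ⟨p + q, fun x => by simp [hp, hq]⟩
  algebraMap_mem' r := ⟨MvPolynomial.C r, fun x => by simp⟩
  star_mem' := by
    rintro f ⟨p, hp⟩
    exact ⟨p, fun x => by simp [hp]⟩

/-- The bounded continuous function `x ↦ e^{-x_i}` on the orthant. -/
noncomputable def expCoord {ι : Type*} [Fintype ι] (i : ι) : (ι → ℝ≥0) →ᵇ ℝ :=
  BoundedContinuousFunction.ofNormedAddCommGroup (fun x => Real.exp (-(x i : ℝ)))
    (by fun_prop) 1 (fun x => by simp)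

/-- A finite measure on the orthant is determined by its Laplace transform at integer points. -/
lemma ext_of_laplace_nnreal {ι : Type*} [Fintype ι] {μ ν : Measure (ι → ℝ≥0)} [IsFiniteMeasure μ]
    [IsFiniteMeasure ν]
    (h : ∀ c : ι → ℕ, ∫ x, Real.exp (-∑ i, c i * (x i : ℝ)) ∂μ =
      ∫ x, Real.exp (-∑ i, c i * (x i : ℝ)) ∂ν) : μ = ν := by
  refine ext_of_forall_mem_subalgebra_integral_eq_of_pseudoEMetric_complete_countable (𝕜 := ℝ)
    (A := expPolynomials ι) ?_ ?_
  -- Points are separated by a single coordinate, since $e^{-x}$ is injective.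
  · intro x y hxy
    obtain ⟨i, hi⟩ := Function.ne_iff.1 hxy
    refine ⟨_, ⟨_, ⟨expCoord i, ⟨MvPolynomial.X i, fun x => ?_⟩, rfl⟩, rfl⟩, ?_⟩
    · simp [expCoord]
    · simpa [expCoord] using hi
  · rintro g ⟨p, hp⟩
    simp_rw [hp, MvPolynomial.eval_eq]
    -- A monomial in the $e^{-x_i}$ is the Laplace kernel at its exponent vector, which is why
    -- integer points are enough.
    have hmon : ∀ (d : ι →₀ ℕ) (x : ι → ℝ≥0), ∏ i ∈ d.support, Real.exp (-(x i : ℝ)) ^ d i =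
        Real.exp (-∑ i, d i * (x i : ℝ)) := by
      intro d x
      rw [← Finset.sum_neg_distrib, Real.exp_sum]
      refine (Finset.prod_subset (Finset.subset_univ _) fun i _ hi => ?_).trans
        (Finset.prod_congr rfl fun i _ => ?_)
      · simp [Finsupp.notMem_support_iff.1 hi]
      · rw [← Real.exp_nat_mul, mul_neg]
    have hint : ∀ (m : Measure (ι → ℝ≥0)) [IsFiniteMeasure m] (d : ι →₀ ℕ),
        Integrable (fun x => p.coeff d * Real.exp (-∑ i, d i * (x i : ℝ))) m := by
      intro m _ d
      refine (Integrable.of_bound (C := 1) ?_ (ae_of_all _ fun x => ?_)).const_mul _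
      · exact (by fun_prop : Continuous fun x : ι → ℝ≥0 =>
          Real.exp (-∑ i, d i * (x i : ℝ))).aestronglyMeasurable
      · rw [Real.norm_eq_abs, Real.abs_exp, Real.exp_le_one_iff, neg_nonpos]
        positivity
    simp_rw [hmon]
    rw [integral_finsetSum _ fun d _ => hint μ d, integral_finsetSum _ fun d _ => hint ν d]
    refine Finset.sum_congr rfl fun d _ => ?_
    rw [integral_const_mul, integral_const_mul, h]

/-- Random vectors in the orthant with the same Laplace transform have the same law. -/
lemma identDistrib_of_laplace {ι Ω Ω' : Type*} [Fintype ι] [MeasurableSpace Ω] [MeasurableSpace Ω']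
    {P : Measure Ω} {P' : Measure Ω'} [IsFiniteMeasure P] [IsFiniteMeasure P']
    {X : Ω → ι → ℝ} {Y : Ω' → ι → ℝ} (hX : AEMeasurable X P) (hY : AEMeasurable Y P')
    (hX0 : ∀ᵐ ω ∂P, ∀ i, 0 ≤ X ω i) (hY0 : ∀ᵐ ω ∂P', ∀ i, 0 ≤ Y ω i)
    (h : ∀ c : ι → ℕ, ∫ ω, Real.exp (-∑ i, c i * X ω i) ∂P =
      ∫ ω, Real.exp (-∑ i, c i * Y ω i) ∂P') : IdentDistrib X Y P P' := by
  refine ⟨hX, hY, ?_⟩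
  -- Truncation to the orthant loses nothing almost surely; `s` undoes it.
  let r : (ι → ℝ) → ι → ℝ≥0 := fun x i => (x i).toNNReal
  have hr : Measurable r := measurable_pi_lambda _ fun i => (measurable_pi_apply i).real_toNNReal
  have hXr : AEMeasurable (fun ω => r (X ω)) P := hr.comp_aemeasurable hX
  have hYr : AEMeasurable (fun ω => r (Y ω)) P' := hr.comp_aemeasurable hY
  let s : (ι → ℝ≥0) → ι → ℝ := fun x i => x i
  have hs : Measurable s :=
    measurable_pi_lambda _ fun i => (measurable_pi_apply i).coe_nnreal_real
  have key : P.map (fun ω => r (X ω)) = P'.map (fun ω => r (Y ω)) := by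
    refine ext_of_laplace_nnreal fun c => ?_
    have hc : Continuous fun x : ι → ℝ≥0 => Real.exp (-∑ i, c i * (x i : ℝ)) := by fun_prop
    rw [integral_map (hXr) hc.aestronglyMeasurable,
      integral_map (hYr) hc.aestronglyMeasurable]
    refine (integral_congr_ae ?_).trans ((h c).trans (integral_congr_ae ?_))
    · filter_upwards [hX0] with ω hω
      simp [r, hω]
    · filter_upwards [hY0] with ω hω
      simp [r, hω]
  have hX' : (fun ω => s (r (X ω))) =ᵐ[P] X := by
    filter_upwards [hX0] with ω hω
    ext i; simp [r, s, hω]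
  have hY' : (fun ω => s (r (Y ω))) =ᵐ[P'] Y := by
    filter_upwards [hY0] with ω hω
    ext i; simp [r, s, hω]
  rw [← Measure.map_congr hX', ← Measure.map_congr hY']
  have e1 : P.map (fun ω => s (r (X ω))) = (P.map fun ω => r (X ω)).map s :=
    (AEMeasurable.map_map_of_aemeasurable hs.aemeasurable (hXr)).symm
  have e2 : P'.map (fun ω => s (r (Y ω))) = (P'.map fun ω => r (Y ω)).map s :=
    (AEMeasurable.map_map_of_aemeasurable hs.aemeasurable (hYr)).symm
  rw [e1, e2, key]

/-! ### Laplace exponents and explicit integrals -/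

lemma lintegral_rpow_mul_exp_neg_mul_Ioi {a r : ℝ} (ha : 0 < a) (hr : 0 < r) :
    ∫⁻ u in Set.Ioi (0 : ℝ), ENNReal.ofReal (u ^ (a - 1) * Real.exp (-(r * u))) =
      ENNReal.ofReal (r ^ (-a) * Real.Gamma a) := by
  have hpos : 0 < (1 / r) ^ a * Real.Gamma a :=
    mul_pos (Real.rpow_pos_of_pos (by positivity) _) (Real.Gamma_pos_of_pos ha)
  have hval := Real.integral_rpow_mul_exp_neg_mul_Ioi ha hr
  have hint : IntegrableOn (fun u : ℝ => u ^ (a - 1) * Real.exp (-(r * u))) (Set.Ioi 0) :=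
    -- The Bochner integral of a non-integrable function is `0`, so a positive value forces
    -- integrability.
    Integrable.of_integral_ne_zero (hval.trans_ne hpos.ne')
  rw [← ofReal_integral_eq_lintegral_ofReal hint, hval, Real.rpow_neg hr.le, one_div,
    Real.inv_rpow hr.le]
  exact (ae_restrict_iff' measurableSet_Ioi).2 (ae_of_all _ fun u hu => by
    have : (0 : ℝ) < u := hu
    positivity)

/-- The Laplace exponent of the stable subordinator is `x ↦ x ^ α`. -/
lemma lintegral_one_sub_exp_stableLevy {α : ℝ} (hα0 : 0 < α) (hα1 : α < 1) {x : ℝ} (hx : 0 ≤ x) :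
    ∫⁻ u, ENNReal.ofReal (1 - Real.exp (-(x * u))) ∂(stableLevy α) = ENNReal.ofReal (x ^ α) := by
  have hΓ : 0 < Real.Gamma (1 - α) := Real.Gamma_pos_of_pos (by linarith)
  -- Writing $1-e^{-xu}=\int_0^x u e^{-yu}\,dy$ gains a factor $u$ that tames the singularity at
  -- `0`; after Tonelli the integral in `u` is a gamma integral.
  have hexp : ∀ u : ℝ, 0 < u → ENNReal.ofReal (1 - Real.exp (-(x * u))) =
      ∫⁻ y in Set.Ioc 0 x, ENNReal.ofReal (u * Real.exp (-(y * u))) := by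
    intro u hu
    have hd : ∀ y ∈ Set.uIcc 0 x, HasDerivAt (fun y => -Real.exp (-(y * u)))
        (u * Real.exp (-(y * u))) y := by
      intro y _
      have := (((hasDerivAt_id y).mul_const u).neg).exp.neg
      exact this.congr_deriv (by simp; ring)
    have hc : Continuous fun y : ℝ => u * Real.exp (-(y * u)) := by fun_prop
    have := intervalIntegral.integral_eq_sub_of_hasDerivAt hd (hc.intervalIntegrable _ _)
    rw [intervalIntegral.integral_of_le hx] at this
    rw [← ofReal_integral_eq_lintegral_ofReal hc.integrableOn_Ioc
      (ae_of_all _ fun y => by positivity), this]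
    congr 1; simp; ring
  rw [stableLevy, lintegral_withDensity_eq_lintegral_mul _ (by fun_prop) (by fun_prop)]
  have h1 : ∀ u ∈ Set.Ioi (0 : ℝ), ((fun u : ℝ => ENNReal.ofReal (α / Real.Gamma (1 - α) *
        u ^ (-(α + 1)))) * fun u => ENNReal.ofReal (1 - Real.exp (-(x * u)))) u =
      ∫⁻ y in Set.Ioc 0 x, ENNReal.ofReal (α / Real.Gamma (1 - α)) *
        ENNReal.ofReal (u ^ ((1 - α) - 1) * Real.exp (-(y * u))) := by
    intro u hu
    have hu : 0 < u := hu
    rw [Pi.mul_apply, hexp u hu, ← lintegral_const_mul _ (by fun_prop)]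
    refine lintegral_congr fun y => ?_
    rw [← ENNReal.ofReal_mul (by positivity), ← ENNReal.ofReal_mul (by positivity)]
    congr 1
    have : u ^ ((1 - α) - 1) = u ^ (-(α + 1)) * u := by
      rw [← Real.rpow_add_one hu.ne']; congr 1; ring
    rw [this]; ring
  rw [setLIntegral_congr_fun measurableSet_Ioi h1, lintegral_lintegral_swap
    (by apply Measurable.aemeasurable; unfold Function.uncurry; fun_prop)]
  have h2 : ∀ y ∈ Set.Ioc 0 x, (∫⁻ u in Set.Ioi (0 : ℝ), ENNReal.ofReal (α / Real.Gamma (1 - α)) *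
        ENNReal.ofReal (u ^ ((1 - α) - 1) * Real.exp (-(y * u)))) =
      ENNReal.ofReal (α * y ^ (α - 1)) := by
    intro y hy
    rw [lintegral_const_mul _ (by fun_prop),
      lintegral_rpow_mul_exp_neg_mul_Ioi (by linarith) hy.1, ← ENNReal.ofReal_mul (by positivity)]
    congr 1
    rw [neg_sub]
    field_simp
  rw [setLIntegral_congr_fun measurableSet_Ioc h2, ← ofReal_integral_eq_lintegral_ofReal,
    ← intervalIntegral.integral_of_le hx, intervalIntegral.integral_const_mul,
    integral_rpow (Or.inl (by linarith))]
  · congr 1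
    rw [sub_add_cancel, Real.zero_rpow hα0.ne', sub_zero]
    field_simp
  · exact ((intervalIntegral.intervalIntegrable_rpow' (by linarith)).const_mul α).1
  · exact (ae_restrict_iff' measurableSet_Ioc).2 (ae_of_all _ fun y hy => by
      have : 0 < y := hy.1
      positivity)

lemma stableLevy_ae_pos (α : ℝ) : ∀ᵐ u ∂(stableLevy α), 0 < u :=
  (withDensity_absolutelyContinuous _ _).ae_le (ae_restrict_mem measurableSet_Ioi)

lemma thinnedLevy_ae_pos (α : ℝ) : ∀ᵐ u ∂(thinnedLevy α), 0 < u :=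
  (withDensity_absolutelyContinuous _ _).ae_le (stableLevy_ae_pos α)

instance (α : ℝ) : SFinite (stableLevy α) := by unfold stableLevy; infer_instance

instance (α : ℝ) : SFinite (thinnedLevy α) := by unfold thinnedLevy; infer_instance

/-- The Laplace exponent of the tempered stable subordinator is `x ↦ (1 + x) ^ α - 1`. -/
lemma lintegral_one_sub_exp_thinnedLevy {α : ℝ} (hα0 : 0 < α) (hα1 : α < 1) {x : ℝ} (hx : 0 ≤ x) :
    ∫⁻ u, ENNReal.ofReal (1 - Real.exp (-(x * u))) ∂(thinnedLevy α) =
      ENNReal.ofReal ((1 + x) ^ α - 1) := by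
  rw [thinnedLevy, lintegral_withDensity_eq_lintegral_mul _ (by fun_prop) (by fun_prop)]
  have h1 := lintegral_one_sub_exp_stableLevy hα0 hα1 zero_le_one
  have h2 := lintegral_one_sub_exp_stableLevy hα0 hα1 (by linarith : (0 : ℝ) ≤ 1 + x)
  rw [ENNReal.ofReal_sub _ zero_le_one, ← h2]
  rw [Real.one_rpow] at h1
  -- The identity behind this is $e^{-u}(1-e^{-xu})+(1-e^{-u})=1-e^{-(1+x)u}$; the added term has
  -- stable integral $1$.
  refine ENNReal.eq_sub_of_add_eq ENNReal.ofReal_ne_top ?_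
  rw [← h1, ← lintegral_add_right _ (by fun_prop)]
  refine lintegral_congr_ae ?_
  filter_upwards [stableLevy_ae_pos α] with u hu
  have hxu : 0 ≤ x * u := by positivity
  rw [Pi.mul_apply, ← ENNReal.ofReal_mul (by positivity), ← ENNReal.ofReal_add]
  · congr 1
    rw [mul_sub, ← Real.exp_add, mul_one, one_mul, add_mul, one_mul]
    ring_nf
  · exact mul_nonneg (Real.exp_nonneg _) (sub_nonneg.2 (Real.exp_le_one_iff.2 (by linarith)))
  · exact sub_nonneg.2 (Real.exp_le_one_iff.2 (by linarith))

lemma gammaMeasure_ae_pos {a r : ℝ} : ∀ᵐ x ∂(gammaMeasure a r), 0 ≤ x := by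
  rw [gammaMeasure, ae_withDensity_iff (by unfold gammaPDF; fun_prop)]
  refine ae_of_all _ fun x hx => ?_
  by_contra! h
  exact hx (gammaPDF_of_neg h)

/-- The Laplace transform of the gamma law. -/
lemma integral_exp_neg_mul_gammaMeasure {a : ℝ} (ha : 0 < a) {x : ℝ} (hx : 0 ≤ x) :
    ∫ y, Real.exp (-(x * y)) ∂(gammaMeasure a 1) = (1 + x) ^ (-a) := by
  have hx1 : 0 < 1 + x := by linarith
  have hΓ : 0 < Real.Gamma a := Real.Gamma_pos_of_pos ha
  rw [gammaMeasure, integral_withDensity_eq_integral_toReal_smul (f := gammaPDF a 1)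
    (by unfold gammaPDF; fun_prop)
    (ae_of_all _ fun y => ENNReal.ofReal_lt_top)]
  have h0 : ∀ y : ℝ, (gammaPDF a 1 y).toReal • Real.exp (-(x * y)) =
      (Set.Ici 0).indicator (fun y => (Real.Gamma a)⁻¹ *
        (y ^ (a - 1) * Real.exp (-((1 + x) * y)))) y := by
    intro y
    rw [gammaPDF, ENNReal.toReal_ofReal (gammaPDFReal_nonneg ha one_pos y), gammaPDFReal]
    by_cases hy : 0 ≤ y
    · rw [if_pos hy, Set.indicator_of_mem (Set.mem_Ici.2 hy), add_mul, neg_add, Real.exp_add,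
        Real.one_rpow, smul_eq_mul]
      ring
    · rw [if_neg hy, Set.indicator_of_notMem (by simpa using hy), zero_smul]
  simp_rw [h0]
  rw [integral_indicator measurableSet_Ici, integral_Ici_eq_integral_Ioi, integral_const_mul,
    Real.integral_rpow_mul_exp_neg_mul_Ioi ha hx1, one_div, Real.inv_rpow hx1.le,
    Real.rpow_neg hx1.le]
  field_simp

lemma integral_exp_neg_mul_expMeasure {x : ℝ} (hx : 0 ≤ x) :
    ∫ y, Real.exp (-(x * y)) ∂(expMeasure 1) = (1 + x)⁻¹ := by
  rw [expMeasure, integral_exp_neg_mul_gammaMeasure one_pos hx, Real.rpow_neg_one]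

/-- The integral of `e^{-r y}` over an interval, against the exponential law. -/
lemma setIntegral_exp_neg_expMeasure {r x y : ℝ} (hr : 0 ≤ r) (hx : 0 ≤ x) (hxy : x ≤ y) :
    ∫ z in Set.Ico x y, Real.exp (-(r * (z - x))) ∂(expMeasure 1) =
      Real.exp (-x) * (1 - Real.exp (-((1 + r) * (y - x)))) / (1 + r) := by
  have hr1 : 0 < 1 + r := by linarith
  rw [expMeasure, gammaMeasure, setIntegral_withDensity_eq_setIntegral_toReal_smul
    (f := gammaPDF 1 1) (by unfold gammaPDF; fun_prop) (ae_of_all _ fun y => ENNReal.ofReal_lt_top) _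
    measurableSet_Ico]
  have h0 : ∀ z ∈ Set.Ico x y, (gammaPDF 1 1 z).toReal • Real.exp (-(r * (z - x))) =
      Real.exp (r * x) * Real.exp (-((1 + r) * z)) := by
    intro z hz
    rw [gammaPDF, ENNReal.toReal_ofReal (gammaPDFReal_nonneg one_pos one_pos z), gammaPDFReal,
      if_pos (hx.trans hz.1)]
    simp only [Real.one_rpow, Real.Gamma_one, sub_self, Real.rpow_zero, smul_eq_mul]
    rw [← Real.exp_add, div_one, one_mul, one_mul, ← Real.exp_add]
    ring_nf
  rw [setIntegral_congr_fun measurableSet_Ico h0, integral_Ico_eq_integral_Ioc,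
    ← intervalIntegral.integral_of_le hxy, intervalIntegral.integral_const_mul]
  have hd : ∀ z ∈ Set.uIcc x y, HasDerivAt (fun z => -Real.exp (-((1 + r) * z)) / (1 + r))
      (Real.exp (-((1 + r) * z))) z := by
    intro z _
    have := ((((hasDerivAt_id z).const_mul (1 + r)).neg).exp.neg).div_const (1 + r)
    refine this.congr_deriv ?_
    rw [mul_one, mul_neg, neg_neg, mul_div_assoc, div_self hr1.ne', mul_one]
    rfl
  rw [intervalIntegral.integral_eq_sub_of_hasDerivAt hd
    ((by fun_prop : Continuous _).intervalIntegrable _ _)]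
  have e1 : Real.exp (r * x) * Real.exp (-((1 + r) * x)) = Real.exp (-x) := by
    rw [← Real.exp_add]; ring_nf
  have e2 : Real.exp (r * x) * Real.exp (-((1 + r) * y)) =
      Real.exp (-x) * Real.exp (-((1 + r) * (y - x))) := by
    rw [← Real.exp_add, ← Real.exp_add]; ring_nf
  linear_combination (e1 - e2) / (1 + r)

/-- An antiderivative is $(cv^{1/\alpha}+k)^\alpha/c$, found by pulling $v^{-1/\alpha}$ out of the
base. The integral is the mixture over the uniform variable. -/
lemma integral_add_mul_rpow_rpow {α c k : ℝ} (hα0 : 0 < α) (hc : 0 < c)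
    (hk : 0 ≤ k) :
    ∫ v in Set.Ioo (0 : ℝ) 1, (c + k * v ^ (-(1 / α))) ^ (-(1 - α)) =
      ((c + k) ^ α - k ^ α) / c := by
  have hα' : 0 < 1 / α := by positivity
  have hcont : ContinuousOn (fun v : ℝ => (c * v ^ (1 / α) + k) ^ α / c) (Set.Icc 0 1) := by
    refine (ContinuousOn.rpow_const ?_ fun _ _ => Or.inr hα0.le).div_const c
    exact ((continuousOn_id.rpow_const fun _ _ => Or.inr hα'.le).const_mul c).add
      continuousOn_const
  have hderiv : ∀ v ∈ Set.Ioo (0 : ℝ) 1, HasDerivAt (fun v : ℝ => (c * v ^ (1 / α) + k) ^ α / c)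
      ((c + k * v ^ (-(1 / α))) ^ (-(1 - α))) v := by
    intro v hv
    have hv0 : 0 < v := hv.1
    have hpos : 0 < c * v ^ (1 / α) + k := by positivity
    have h1 := (((((Real.hasDerivAt_rpow_const (p := 1 / α) (Or.inl hv0.ne')).const_mul c).add_const
      k).rpow_const (p := α) (Or.inl hpos.ne')).div_const c)
    refine h1.congr_deriv ?_
    have h2 : c + k * v ^ (-(1 / α)) = (c * v ^ (1 / α) + k) * v ^ (-(1 / α)) := by
      rw [add_mul, mul_assoc, ← Real.rpow_add hv0, add_neg_cancel, Real.rpow_zero, mul_one]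
    rw [h2, Real.mul_rpow hpos.le (by positivity), ← Real.rpow_mul hv0.le,
      show -(1 / α) * -(1 - α) = 1 / α - 1 by field_simp, show -(1 - α) = α - 1 by ring]
    field_simp
  have hnonneg : ∀ v ∈ Set.Ioo (0 : ℝ) 1, 0 ≤ (c + k * v ^ (-(1 / α))) ^ (-(1 - α)) := by
    intro v hv
    have := hv.1
    positivity
  -- The derivative formula holds only inside the interval; integrability comes from its sign and
  -- continuity of the antiderivative up to the ends.
  have hint := intervalIntegral.integrableOn_deriv_of_nonneg hcont hderiv hnonneg
  rw [← integral_Ioc_eq_integral_Ioo, ← intervalIntegral.integral_of_le zero_le_one,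
    intervalIntegral.integral_eq_sub_of_hasDerivAt_of_le zero_le_one hcont hderiv
      ((intervalIntegrable_iff_integrableOn_Ioc_of_le zero_le_one).2 hint)]
  rw [Real.one_rpow, Real.zero_rpow hα'.ne']
  simp only [mul_one, mul_zero, zero_add]
  ring

/-! ### Deterministic properties of the jump path -/

/-- The increment `∑_{s < T_i ≤ t} P_i` over a time interval. -/
noncomputable def jumpIncr (m : Measure (ℝ × ℝ)) (s t : ℝ) : ℝ≥0∞ :=
  ∫⁻ p in {p : ℝ × ℝ | s < p.1 ∧ p.1 ≤ t}, ENNReal.ofReal p.2 ∂m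

lemma measurableSet_fst_le (t : ℝ) : MeasurableSet {p : ℝ × ℝ | p.1 ≤ t} :=
  measurableSet_le measurable_fst measurable_const

lemma measurableSet_fst_mem_Ioc (s t : ℝ) : MeasurableSet {p : ℝ × ℝ | s < p.1 ∧ p.1 ≤ t} :=
  (measurableSet_lt measurable_const measurable_fst).inter (measurableSet_fst_le t)

lemma jumpSum_mono (m : Measure (ℝ × ℝ)) : Monotone (jumpSum m) := fun _ _ hst =>
  lintegral_mono_set fun _ hp => le_trans hp hst

lemma jumpSum_add_jumpIncr (m : Measure (ℝ × ℝ)) {s t : ℝ} (hst : s ≤ t) :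
    jumpSum m s + jumpIncr m s t = jumpSum m t := by
  unfold jumpSum jumpIncr
  rw [← lintegral_union (measurableSet_fst_mem_Ioc s t)]
  · congr 2
    ext p
    simp only [Set.mem_union, Set.mem_ofPred_eq]
    constructor
    · rintro (h | h)
      · exact h.trans hst
      · exact h.2
    · intro h
      by_cases h' : p.1 ≤ s
      · exact Or.inl h'
      · exact Or.inr ⟨not_le.1 h', h⟩
  · rw [Set.disjoint_left]
    intro p hp hp'
    exact absurd hp'.1 (not_lt.2 hp)

lemma measurable_jumpSum (t : ℝ) : Measurable fun m : Measure (ℝ × ℝ) => jumpSum m t := by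
  unfold jumpSum
  simp_rw [← lintegral_indicator (measurableSet_fst_le t)]
  exact Measure.measurable_lintegral
    ((measurable_snd.ennreal_ofReal).indicator (measurableSet_fst_le t))

/-- A pure jump path with finite values is right continuous. -/
lemma continuousWithinAt_jumpSum {m : Measure (ℝ × ℝ)} (hm : ∀ t, jumpSum m t < ∞) (t : ℝ) :
    ContinuousWithinAt (jumpSum m) (Set.Ici t) t := by
  have h : ∀ s, jumpSum m s = ∫⁻ p, {p : ℝ × ℝ | p.1 ≤ s}.indicator
      (fun p => ENNReal.ofReal p.2) p ∂m :=
    fun s => (lintegral_indicator (measurableSet_fst_le s) _).symm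
  rw [ContinuousWithinAt, funext h]
  refine tendsto_lintegral_filter_of_dominated_convergence
    ({p : ℝ × ℝ | p.1 ≤ t + 1}.indicator fun p => ENNReal.ofReal p.2)
    (Filter.Eventually.of_forall fun s =>
      (measurable_snd.ennreal_ofReal).indicator (measurableSet_fst_le s)) ?_ ?_ ?_
  · have : ∀ᶠ s in nhdsWithin t (Set.Ici t), s ≤ t + 1 :=
      nhdsWithin_le_nhds (Iic_mem_nhds (by linarith))
    filter_upwards [this] with s hs
    refine ae_of_all _ fun p => ?_
    exact Set.indicator_le_indicator_of_subset (fun q hq => le_trans hq hs)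
      (fun _ => zero_le) p
  · rw [← h]; exact (hm _).ne
  · refine ae_of_all _ fun p => ?_
    refine tendsto_const_nhds.congr' ?_
    by_cases hp : p.1 ≤ t
    · filter_upwards [self_mem_nhdsWithin] with s hs
      rw [Set.indicator_of_mem (show p ∈ {p : ℝ × ℝ | p.1 ≤ t} from hp),
        Set.indicator_of_mem (show p ∈ {p : ℝ × ℝ | p.1 ≤ s} from hp.trans hs)]
    · have : ∀ᶠ s in nhdsWithin t (Set.Ici t), s < p.1 :=
        nhdsWithin_le_nhds (Iio_mem_nhds (not_le.1 hp))
      filter_upwards [this] with s hs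
      rw [Set.indicator_of_notMem (show p ∉ {p : ℝ × ℝ | p.1 ≤ t} from hp),
        Set.indicator_of_notMem (show p ∉ {p : ℝ × ℝ | p.1 ≤ s} from not_le.2 hs)]

/-! ### Subordinators with a given Laplace exponent -/

/-- The Lévy measure `μ` on `[0, ∞)` has the Laplace exponent `ψ`. -/
structure HasLaplaceExponent (μ : Measure ℝ) (ψ : ℝ → ℝ) : Prop where
  ae_nonneg : ∀ᵐ u ∂μ, 0 ≤ u
  nonneg : ∀ x, 0 ≤ x → 0 ≤ ψ x
  lintegral_eq : ∀ x, 0 ≤ x →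
    ∫⁻ u, ENNReal.ofReal (1 - Real.exp (-(x * u))) ∂μ = ENNReal.ofReal (ψ x)
  tendsto_zero : Filter.Tendsto ψ (nhdsWithin 0 (Set.Ioi 0)) (nhds 0)

lemma hasLaplaceExponent_stableLevy {α : ℝ} (hα0 : 0 < α) (hα1 : α < 1) :
    HasLaplaceExponent (stableLevy α) fun x => x ^ α where
  ae_nonneg := (stableLevy_ae_pos α).mono fun _ h => h.le
  nonneg x hx := by positivity
  lintegral_eq x hx := lintegral_one_sub_exp_stableLevy hα0 hα1 hx
  tendsto_zero := by
    have := (Real.continuous_rpow_const hα0.le).tendsto 0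
    rw [Real.zero_rpow hα0.ne'] at this
    exact this.mono_left nhdsWithin_le_nhds

lemma hasLaplaceExponent_thinnedLevy {α : ℝ} (hα0 : 0 < α) (hα1 : α < 1) :
    HasLaplaceExponent (thinnedLevy α) fun x => (1 + x) ^ α - 1 where
  ae_nonneg := (thinnedLevy_ae_pos α).mono fun _ h => h.le
  nonneg x hx := sub_nonneg.2 (Real.one_le_rpow (by linarith) hα0.le)
  lintegral_eq x hx := lintegral_one_sub_exp_thinnedLevy hα0 hα1 hx
  tendsto_zero := by
    have : Continuous fun x : ℝ => (1 + x) ^ α - 1 :=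
      ((continuous_const.add continuous_id).rpow_const fun _ => Or.inr hα0.le).sub continuous_const
    have := this.tendsto 0
    rw [add_zero, Real.one_rpow, sub_self] at this
    exact this.mono_left nhdsWithin_le_nhds

namespace HasLaplaceExponent

variable {Ω : Type*} [MeasurableSpace Ω] {P : Measure Ω} [IsProbabilityMeasure P]
  {μ : Measure ℝ} [SFinite μ] {ψ : ℝ → ℝ} {N : Ω → Measure (ℝ × ℝ)}

lemma lintegral_timeJumpIntensity (hψ : HasLaplaceExponent μ ψ) {s t x y : ℝ} (hs : 0 ≤ s)
    (hst : s ≤ t) (hx : 0 ≤ x) (hy : 0 ≤ y) :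
    ∫⁻ p, ENNReal.ofReal (1 - expNeg (
        {p : ℝ × ℝ | p.1 ≤ s}.indicator (fun p => ENNReal.ofReal x * ENNReal.ofReal p.2) p +
        {p : ℝ × ℝ | s < p.1 ∧ p.1 ≤ t}.indicator
          (fun p => ENNReal.ofReal y * ENNReal.ofReal p.2) p)) ∂(timeJumpIntensity μ) =
      ENNReal.ofReal (s * ψ x + (t - s) * ψ y) := by
  have hae : ∀ᵐ p ∂(timeJumpIntensity μ), 0 ≤ p.2 :=
    Measure.quasiMeasurePreserving_snd.ae hψ.ae_nonneg
  have hcongr : ∀ᵐ p ∂(timeJumpIntensity μ), ENNReal.ofReal (1 - expNeg (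
        {p : ℝ × ℝ | p.1 ≤ s}.indicator (fun p => ENNReal.ofReal x * ENNReal.ofReal p.2) p +
        {p : ℝ × ℝ | s < p.1 ∧ p.1 ≤ t}.indicator
          (fun p => ENNReal.ofReal y * ENNReal.ofReal p.2) p)) =
      (Set.Iic s).indicator (fun _ => 1) p.1 * ENNReal.ofReal (1 - Real.exp (-(x * p.2))) +
      (Set.Ioc s t).indicator (fun _ => 1) p.1 * ENNReal.ofReal (1 - Real.exp (-(y * p.2))) := by
    filter_upwards [hae] with p hp
    have hexp : ∀ z : ℝ, 0 ≤ z →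
        expNeg (ENNReal.ofReal z * ENNReal.ofReal p.2) = Real.exp (-(z * p.2)) := by
      intro z hz
      rw [← ENNReal.ofReal_mul hz, expNeg_ofReal (mul_nonneg hz hp)]
    by_cases h1 : p.1 ≤ s
    · simp [Set.indicator, h1, not_lt.2 h1, hexp x hx]
    · by_cases h2 : p.1 ≤ t
      · simp [Set.indicator, h1, h2, not_le.1 h1, hexp y hy]
      · simp [Set.indicator, h1, h2]
  rw [lintegral_congr_ae hcongr, lintegral_add_left (by
    refine Measurable.mul ?_ (by fun_prop)
    exact (measurable_const.indicator measurableSet_Iic).comp measurable_fst), timeJumpIntensity,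
    lintegral_prod_mul (measurable_const.indicator measurableSet_Iic).aemeasurable
      (g := fun u => ENNReal.ofReal (1 - Real.exp (-(x * u)))) (by fun_prop),
    lintegral_prod_mul (measurable_const.indicator measurableSet_Ioc).aemeasurable
      (g := fun u => ENNReal.ofReal (1 - Real.exp (-(y * u)))) (by fun_prop),
    hψ.lintegral_eq x hx, hψ.lintegral_eq y hy, lintegral_indicator measurableSet_Iic,
    lintegral_indicator measurableSet_Ioc, setLIntegral_one, setLIntegral_one,
    Measure.restrict_apply measurableSet_Iic, Measure.restrict_apply measurableSet_Ioc,
    Set.Iic_inter_Ioi, Real.volume_Ioc,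
    Set.inter_eq_left.2 (show Set.Ioc s t ⊆ Set.Ioi 0 from fun z hz => lt_of_le_of_lt hs hz.1), Real.volume_Ioc, sub_zero,
    ← ENNReal.ofReal_mul hs, ← ENNReal.ofReal_mul (sub_nonneg.2 hst), ← ENNReal.ofReal_add]
  · exact mul_nonneg hs (hψ.nonneg x hx)
  · exact mul_nonneg (sub_nonneg.2 hst) (hψ.nonneg y hy)

/-- One application of the Laplace functional handles both disjoint time strips, so independence of
increments is never needed separately. Values stay in `[0, ∞]` because finiteness of the path is
deduced from this formula. -/
lemma integral_expNeg_add (hψ : HasLaplaceExponent μ ψ)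
    (hN : IsPoissonPointProcess N (timeJumpIntensity μ) P) {s t x y : ℝ} (hs : 0 ≤ s)
    (hst : s ≤ t) (hx : 0 ≤ x) (hy : 0 ≤ y) :
    ∫ ω, expNeg (ENNReal.ofReal x * jumpSum (N ω) s + ENNReal.ofReal y * jumpIncr (N ω) s t) ∂P =
      Real.exp (-(s * ψ x + (t - s) * ψ y)) := by
  have hmeas : ∀ z : ℝ, Measurable fun p : ℝ × ℝ => ENNReal.ofReal z * ENNReal.ofReal p.2 :=
    fun z => by fun_prop
  have hm1 := (hmeas x).indicator (measurableSet_fst_le s)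
  have hm2 := (hmeas y).indicator (measurableSet_fst_mem_Ioc s t)
  have h := hN.integral_expNeg (hm1.add hm2)
  simp only [Pi.add_apply] at h
  rw [hψ.lintegral_timeJumpIntensity hs hst hx hy, expNeg_ofReal (add_nonneg
    (mul_nonneg hs (hψ.nonneg x hx)) (mul_nonneg (sub_nonneg.2 hst) (hψ.nonneg y hy)))] at h
  rw [← h]
  congr 1
  ext ω
  rw [lintegral_add_left hm1, lintegral_indicator (measurableSet_fst_le s),
    lintegral_indicator (measurableSet_fst_mem_Ioc s t), lintegral_const_mul _ (by fun_prop),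
    lintegral_const_mul _ (by fun_prop)]
  rfl

lemma integral_expNeg_jumpSum (hψ : HasLaplaceExponent μ ψ)
    (hN : IsPoissonPointProcess N (timeJumpIntensity μ) P) {s x : ℝ} (hs : 0 ≤ s) (hx : 0 ≤ x) :
    ∫ ω, expNeg (ENNReal.ofReal x * jumpSum (N ω) s) ∂P = Real.exp (-(s * ψ x)) := by
  have := hψ.integral_expNeg_add hN hs le_rfl hx le_rfl
  simpa using this

lemma integrable_expNeg {f : Ω → ℝ≥0∞} (hf : Measurable f) : Integrable (fun ω => expNeg (f ω)) P :=
  Integrable.of_bound (C := 1) (measurable_expNeg.comp hf).aestronglyMeasurable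
    (ae_of_all _ fun _ => norm_expNeg_le_one _)

/-- For $x>0$ the kernel vanishes at `∞`, so $e^{-n\psi(x)}=E\,e^{-x\tau_n}\le P(\tau_n<\infty)$;
let $x\downarrow0$ and use $\psi(x)\to0$. Monotonicity extends integer times to all times. -/
lemma ae_jumpSum_lt_top (hψ : HasLaplaceExponent μ ψ)
    (hN : IsPoissonPointProcess N (timeJumpIntensity μ) P) :
    ∀ᵐ ω ∂P, ∀ t, jumpSum (N ω) t < ∞ := by
  have key : ∀ n : ℕ, ∀ᵐ ω ∂P, jumpSum (N ω) n < ∞ := by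
    intro n
    have hmJ : Measurable fun ω => jumpSum (N ω) n := (measurable_jumpSum n).comp hN.measurable
    have hS : MeasurableSet {ω | jumpSum (N ω) n < ∞} := measurableSet_lt hmJ measurable_const
    have hle : ∀ x ∈ Set.Ioi (0 : ℝ), Real.exp (-(n * ψ x)) ≤
        P.real {ω | jumpSum (N ω) n < ∞} := by
      intro x hx
      rw [← hψ.integral_expNeg_jumpSum hN n.cast_nonneg (le_of_lt hx), ← integral_indicator_one hS]
      refine integral_mono (integrable_expNeg (hmJ.const_mul _))
        ((integrable_const (1 : ℝ)).indicator hS) fun ω => ?_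
      by_cases h : jumpSum (N ω) n < ∞
      · rw [Set.indicator_of_mem (show ω ∈ {ω | jumpSum (N ω) n < ∞} from h)]
        exact expNeg_le_one _
      · have hx' : ENNReal.ofReal x ≠ 0 := (ENNReal.ofReal_pos.2 hx).ne'
        simp [not_lt_top_iff.1 h, ENNReal.mul_top hx']
    have hlim : Filter.Tendsto (fun x => Real.exp (-(n * ψ x))) (nhdsWithin 0 (Set.Ioi 0))
        (nhds 1) := by
      have := (Real.continuous_exp.tendsto _).comp ((hψ.tendsto_zero.const_mul (n : ℝ)).neg)
      simpa [Function.comp_def] using this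
    have h1 : 1 ≤ P.real {ω | jumpSum (N ω) n < ∞} :=
      le_of_tendsto hlim (by filter_upwards [self_mem_nhdsWithin] with x hx using hle x hx)
    have h2 : P {ω | jumpSum (N ω) n < ∞} = 1 := by
      refine le_antisymm prob_le_one ?_
      rw [← ENNReal.toReal_le_toReal ENNReal.one_ne_top (measure_ne_top _ _)]
      exact h1
    exact (prob_compl_eq_zero_iff hS).2 h2
  filter_upwards [ae_all_iff.2 key] with ω hω t
  obtain ⟨n, hn⟩ := exists_nat_ge t
  exact (jumpSum_mono _ hn).trans_lt (hω n)

lemma ae_jumpSum_zero (hψ : HasLaplaceExponent μ ψ)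
    (hN : IsPoissonPointProcess N (timeJumpIntensity μ) P) :
    ∀ᵐ ω ∂P, jumpSum (N ω) 0 = 0 := by
  have hmJ : Measurable fun ω => jumpSum (N ω) 0 := (measurable_jumpSum 0).comp hN.measurable
  have h := hψ.integral_expNeg_jumpSum hN le_rfl zero_le_one
  simp only [ENNReal.ofReal_one, one_mul, zero_mul, neg_zero, Real.exp_zero] at h
  have h0 : ∫ ω, (1 - expNeg (jumpSum (N ω) 0)) ∂P = 0 := by
    rw [integral_sub (integrable_const _) (integrable_expNeg hmJ), h]; simp
  rw [integral_eq_zero_iff_of_nonneg (fun ω => sub_nonneg.2 (expNeg_le_one _))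
    ((integrable_const _).sub (integrable_expNeg hmJ))] at h0
  filter_upwards [h0] with ω hω
  exact expNeg_eq_one_iff.1 (sub_eq_zero.1 hω).symm

/-- Since $E\,e^{-\sup_n\tau_n}\le e^{-n\psi(1)}$ for every $n$, the left side is `0` and the
supremum is infinite almost surely. -/
lemma ae_exists_lt_jumpSum (hψ : HasLaplaceExponent μ ψ) (hψ1 : 0 < ψ 1)
    (hN : IsPoissonPointProcess N (timeJumpIntensity μ) P) :
    ∀ᵐ ω ∂P, ∀ s : ℝ, ∃ t : ℝ, 0 ≤ t ∧ ENNReal.ofReal s < jumpSum (N ω) t := by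
  have hmJ : ∀ n : ℕ, Measurable fun ω => jumpSum (N ω) n :=
    fun n => (measurable_jumpSum n).comp hN.measurable
  have hmS : Measurable fun ω => ⨆ n : ℕ, jumpSum (N ω) n := Measurable.iSup hmJ
  have hle : ∀ n : ℕ, ∫ ω, expNeg (⨆ n : ℕ, jumpSum (N ω) n) ∂P ≤ Real.exp (-ψ 1) ^ n := by
    intro n
    have h := hψ.integral_expNeg_jumpSum hN (s := n) n.cast_nonneg zero_le_one
    rw [← Real.exp_nat_mul, mul_neg, ← h]
    simp only [ENNReal.ofReal_one, one_mul]
    exact integral_mono (integrable_expNeg hmS) (integrable_expNeg (hmJ n)) fun ω =>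
      expNeg_antitone (le_iSup (fun n : ℕ => jumpSum (N ω) n) n)
  have h0 : ∫ ω, expNeg (⨆ n : ℕ, jumpSum (N ω) n) ∂P = 0 := by
    refine le_antisymm ?_ (integral_nonneg fun ω => expNeg_nonneg _)
    exact ge_of_tendsto' (tendsto_pow_atTop_nhds_zero_of_lt_one (Real.exp_nonneg _)
      (Real.exp_lt_one_iff.2 (neg_lt_zero.2 hψ1))) hle
  rw [integral_eq_zero_iff_of_nonneg (fun ω => expNeg_nonneg _) (integrable_expNeg hmS)] at h0
  filter_upwards [h0] with ω hω s
  have htop : ⨆ n : ℕ, jumpSum (N ω) n = ∞ := expNeg_eq_zero_iff.1 hω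
  obtain ⟨n, hn⟩ := lt_iSup_iff.1 (htop ▸ ENNReal.ofReal_lt_top (r := s))
  exact ⟨n, n.cast_nonneg, hn⟩

/-- The joint Laplace transform of a subordinator and its increment. -/
lemma integral_exp_neg_jumpSum (hψ : HasLaplaceExponent μ ψ)
    (hN : IsPoissonPointProcess N (timeJumpIntensity μ) P) {s t x y : ℝ} (hs : 0 ≤ s)
    (hst : s ≤ t) (hx : 0 ≤ x) (hy : 0 ≤ y) :
    ∫ ω, Real.exp (-(x * (jumpSum (N ω) s).toReal +
        y * ((jumpSum (N ω) t).toReal - (jumpSum (N ω) s).toReal))) ∂P =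
      Real.exp (-(s * ψ x + (t - s) * ψ y)) := by
  rw [← hψ.integral_expNeg_add hN hs hst hx hy]
  refine integral_congr_ae ?_
  filter_upwards [hψ.ae_jumpSum_lt_top hN] with ω hω
  have h := jumpSum_add_jumpIncr (N ω) hst
  have h1 : jumpSum (N ω) s ≠ ∞ := (hω s).ne
  have h2 : jumpIncr (N ω) s t ≠ ∞ := by
    refine ne_top_of_le_ne_top (hω t).ne ?_
    rw [← h]; exact le_add_self
  rw [← h, expNeg_of_ne_top (ENNReal.add_ne_top.2 ⟨ENNReal.mul_ne_top ENNReal.ofReal_ne_top h1,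
    ENNReal.mul_ne_top ENNReal.ofReal_ne_top h2⟩), ENNReal.toReal_add h1 h2, ENNReal.toReal_add
    (ENNReal.mul_ne_top ENNReal.ofReal_ne_top h1) (ENNReal.mul_ne_top ENNReal.ofReal_ne_top h2),
    ENNReal.toReal_mul, ENNReal.toReal_mul, ENNReal.toReal_ofReal hx, ENNReal.toReal_ofReal hy,
    add_sub_cancel_left]

end HasLaplaceExponent

/-! ### Dyadic approximation of the crossing -/

/-- The dyadic times `k / 2 ^ n`. -/
noncomputable def dyadicTime (n k : ℕ) : ℝ := k / 2 ^ n

lemma dyadicTime_zero (n : ℕ) : dyadicTime n 0 = 0 := by simp [dyadicTime]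

lemma dyadicTime_nonneg (n k : ℕ) : 0 ≤ dyadicTime n k := by unfold dyadicTime; positivity

lemma dyadicTime_succ_sub (n k : ℕ) : dyadicTime n (k + 1) - dyadicTime n k = (2 ^ n)⁻¹ := by
  unfold dyadicTime; push_cast; ring

lemma dyadicTime_mono (n : ℕ) : Monotone (dyadicTime n) := fun _ _ h =>
  div_le_div_of_nonneg_right (Nat.cast_le.2 h) (by positivity)

lemma tendsto_inv_two_pow : Filter.Tendsto (fun n : ℕ => ((2 : ℝ) ^ n)⁻¹) Filter.atTop (nhds 0) := by
  have := tendsto_pow_atTop_nhds_zero_of_lt_one (r := (2 : ℝ)⁻¹) (by norm_num) (by norm_num)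
  simpa [inv_pow] using this

/-- The index of the dyadic interval of level `n` in which the path crosses the level `s`. -/
noncomputable def crossingIndex (n : ℕ) (m : Measure (ℝ × ℝ)) (s : ℝ) : ℕ :=
  sInf {k : ℕ | ENNReal.ofReal s < jumpSum m (dyadicTime n (k + 1))}

/-- The path is finite, starts at `0` and tends to `∞`, and it does not take the value `s > 0` at a
dyadic time. -/
structure IsGenericPath (m : Measure (ℝ × ℝ)) (s : ℝ) : Prop where
  pos : 0 < s
  lt_top : ∀ t, jumpSum m t < ∞
  zero : jumpSum m 0 = 0
  exists_lt : ∃ t : ℝ, 0 ≤ t ∧ ENNReal.ofReal s < jumpSum m t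
  ne_dyadic : ∀ n k, jumpSum m (dyadicTime n k) ≠ ENNReal.ofReal s

namespace IsGenericPath

variable {m : Measure (ℝ × ℝ)} {s : ℝ}

lemma crossingIndex_mem (h : IsGenericPath m s) (n : ℕ) :
    ENNReal.ofReal s < jumpSum m (dyadicTime n (crossingIndex n m s + 1)) := by
  have hne : {k : ℕ | ENNReal.ofReal s < jumpSum m (dyadicTime n (k + 1))}.Nonempty := by
    obtain ⟨t, _, ht⟩ := h.exists_lt
    obtain ⟨k, hk⟩ := exists_nat_ge (t * 2 ^ n)
    refine ⟨k, ht.trans_le (jumpSum_mono m ?_)⟩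
    refine le_trans ?_ (dyadicTime_mono n (Nat.le_succ k))
    rwa [dyadicTime, le_div_iff₀ (by positivity)]
  exact Nat.sInf_mem hne

/-- Minimality of the index only gives `≤`; `ne_dyadic` makes it strict. Strictness is what later
places the dyadic time strictly to the left of `inverseTime`. -/
lemma jumpSum_crossingIndex_lt (h : IsGenericPath m s) (n : ℕ) :
    jumpSum m (dyadicTime n (crossingIndex n m s)) < ENNReal.ofReal s := by
  rcases hk : crossingIndex n m s with _ | k
  · rw [dyadicTime_zero, h.zero]
    exact ENNReal.ofReal_pos.2 h.pos
  · have : k ∉ {k : ℕ | ENNReal.ofReal s < jumpSum m (dyadicTime n (k + 1))} :=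
      Nat.notMem_of_lt_sInf (by change k < crossingIndex n m s; omega)
    exact lt_of_le_of_ne (not_lt.1 this) (h.ne_dyadic n (k + 1))

/-- By monotonicity the first crossing is visible from the two endpoint values alone, so the event
involves only two times of the path. -/
lemma crossingIndex_eq_iff (h : IsGenericPath m s) (n k : ℕ) :
    crossingIndex n m s = k ↔ (jumpSum m (dyadicTime n k)).toReal ≤ s ∧
      s < (jumpSum m (dyadicTime n (k + 1))).toReal := by
  rw [← ENNReal.le_ofReal_iff_toReal_le (h.lt_top _).ne h.pos.le,
    ← ENNReal.ofReal_lt_iff_lt_toReal h.pos.le (h.lt_top _).ne]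
  constructor
  · rintro rfl
    exact ⟨(h.jumpSum_crossingIndex_lt n).le, h.crossingIndex_mem n⟩
  · rintro ⟨h1, h2⟩
    refine le_antisymm (Nat.sInf_le h2) ?_
    by_contra! hlt
    exact absurd (h.crossingIndex_mem n)
      (not_lt.2 ((jumpSum_mono m (dyadicTime_mono n hlt)).trans h1))

lemma bddBelow : BddBelow {t : ℝ | 0 ≤ t ∧ ENNReal.ofReal s < jumpSum m t} :=
  ⟨0, fun _ ht => ht.1⟩

lemma inverseTime_le (h : IsGenericPath m s) (n : ℕ) :
    inverseTime m s ≤ dyadicTime n (crossingIndex n m s + 1) :=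
  csInf_le bddBelow ⟨dyadicTime_nonneg _ _, h.crossingIndex_mem n⟩

lemma lt_inverseTime (h : IsGenericPath m s) (n : ℕ) :
    dyadicTime n (crossingIndex n m s) < inverseTime m s := by
  set t₀ := dyadicTime n (crossingIndex n m s)
  -- Right continuity keeps the path below `s` for a short while after `t₀`, hence the crossing
  -- happens strictly later.
  have hev : ∀ᶠ t in nhdsWithin t₀ (Set.Ioi t₀), jumpSum m t < ENNReal.ofReal s :=
    nhdsWithin_mono _ Set.Ioi_subset_Ici_self
      ((continuousWithinAt_jumpSum h.lt_top t₀).eventually_lt_const (h.jumpSum_crossingIndex_lt n))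
  obtain ⟨t, ht, ht₀⟩ := (hev.and self_mem_nhdsWithin).exists
  refine lt_of_lt_of_le ht₀ (le_csInf h.exists_lt fun u hu => ?_)
  by_contra! hlt
  exact absurd hu.2 (not_lt.2 ((jumpSum_mono m hlt.le).trans ht.le))

lemma inverseTime_pos (h : IsGenericPath m s) : 0 < inverseTime m s :=
  (dyadicTime_nonneg _ _).trans_lt (h.lt_inverseTime 0)

lemma tendsto_dyadicTime (h : IsGenericPath m s) :
    Filter.Tendsto (fun n => dyadicTime n (crossingIndex n m s)) Filter.atTop
      (nhds (inverseTime m s)) := by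
  have h1 : Filter.Tendsto (fun n : ℕ => inverseTime m s - ((2 : ℝ) ^ n)⁻¹) Filter.atTop
      (nhds (inverseTime m s)) := by
    simpa using tendsto_inv_two_pow.const_sub (inverseTime m s)
  refine tendsto_of_tendsto_of_tendsto_of_le_of_le h1 tendsto_const_nhds (fun n => ?_)
    fun n => (h.lt_inverseTime n).le
  have := h.inverseTime_le n
  have := dyadicTime_succ_sub n (crossingIndex n m s)
  simp only
  linarith

lemma tendsto_dyadicTime_succ (h : IsGenericPath m s) :
    Filter.Tendsto (fun n => dyadicTime n (crossingIndex n m s + 1)) Filter.atTop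
      (nhds (inverseTime m s)) := by
  have := h.tendsto_dyadicTime.add tendsto_inv_two_pow
  rw [add_zero] at this
  refine this.congr fun n => ?_
  rw [← dyadicTime_succ_sub n (crossingIndex n m s)]
  ring

/-- The left dyadic times approach the crossing time strictly from below, so they see the left
limit. The right ones may equal it, and right continuity covers them. -/
lemma tendsto_leftEnd (h : IsGenericPath m s) :
    Filter.Tendsto (fun n => (jumpSum m (dyadicTime n (crossingIndex n m s))).toReal) Filter.atTop
      (nhds (leftEnd m s)) := by
  have hlim : Filter.Tendsto (fun n => dyadicTime n (crossingIndex n m s)) Filter.atTop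
      (nhdsWithin (inverseTime m s) (Set.Iio (inverseTime m s))) :=
    tendsto_nhdsWithin_iff.2 ⟨h.tendsto_dyadicTime, Filter.Eventually.of_forall h.lt_inverseTime⟩
  have hne : Function.leftLim (jumpSum m) (inverseTime m s) ≠ ∞ :=
    ne_top_of_le_ne_top (h.lt_top _).ne ((jumpSum_mono m).leftLim_le le_rfl)
  exact (ENNReal.tendsto_toReal hne).comp (((jumpSum_mono m).tendsto_leftLim _).comp hlim)

lemma tendsto_rightEnd (h : IsGenericPath m s) :
    Filter.Tendsto (fun n => (jumpSum m (dyadicTime n (crossingIndex n m s + 1))).toReal)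
      Filter.atTop (nhds (rightEnd m s)) := by
  have hlim : Filter.Tendsto (fun n => dyadicTime n (crossingIndex n m s + 1)) Filter.atTop
      (nhdsWithin (inverseTime m s) (Set.Ici (inverseTime m s))) :=
    tendsto_nhdsWithin_iff.2 ⟨h.tendsto_dyadicTime_succ, Filter.Eventually.of_forall h.inverseTime_le⟩
  exact (ENNReal.tendsto_toReal (h.lt_top _).ne).comp
    ((continuousWithinAt_jumpSum h.lt_top _).tendsto.comp hlim)

lemma leftEnd_le (h : IsGenericPath m s) : leftEnd m s ≤ s :=
  le_of_tendsto' h.tendsto_leftEnd fun n => ((h.crossingIndex_eq_iff n _).1 rfl).1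

lemma le_rightEnd (h : IsGenericPath m s) : s ≤ rightEnd m s :=
  ge_of_tendsto' h.tendsto_rightEnd fun n => ((h.crossingIndex_eq_iff n _).1 rfl).2.le

end IsGenericPath

lemma measurable_crossingIndex (n : ℕ) :
    Measurable fun p : Measure (ℝ × ℝ) × ℝ => crossingIndex n p.1 p.2 := by
  have hS : ∀ k : ℕ, MeasurableSet
      {p : Measure (ℝ × ℝ) × ℝ | ENNReal.ofReal p.2 < jumpSum p.1 (dyadicTime n (k + 1))} :=
    fun k => measurableSet_lt (by fun_prop) ((measurable_jumpSum _).comp measurable_fst)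
  refine measurable_of_Iic fun k => ?_
  -- If the level is never crossed, the index is `sInf ∅ = 0`, which lies in every `Set.Iic k`;
  -- hence the second set in the union.
  have : (fun p : Measure (ℝ × ℝ) × ℝ => crossingIndex n p.1 p.2) ⁻¹' Set.Iic k =
      (⋃ j ∈ Set.Iic k,
        {p | ENNReal.ofReal p.2 < jumpSum p.1 (dyadicTime n (j + 1))}) ∪
      ⋂ j, {p | ENNReal.ofReal p.2 < jumpSum p.1 (dyadicTime n (j + 1))}ᶜ := by
    ext p
    simp only [Set.mem_preimage, Set.mem_Iic, Set.mem_union, Set.mem_iUnion, Set.mem_iInter,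
      Set.mem_compl_iff, exists_prop]
    constructor
    · intro h
      rcases Set.eq_empty_or_nonempty
        {k : ℕ | ENNReal.ofReal p.2 < jumpSum p.1 (dyadicTime n (k + 1))} with he | hne
      · exact Or.inr fun j hj => Set.eq_empty_iff_forall_notMem.1 he j hj
      · exact Or.inl ⟨_, h, Nat.sInf_mem hne⟩
    · rintro (⟨j, hj, hp⟩ | h)
      · exact (Nat.sInf_le hp).trans hj
      · have he : {k : ℕ | ENNReal.ofReal p.2 < jumpSum p.1 (dyadicTime n (k + 1))} = ∅ :=
          Set.eq_empty_iff_forall_notMem.2 fun j hj => h j hj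
        simp [crossingIndex, he]
  rw [this]
  exact (MeasurableSet.biUnion (Set.to_countable _) fun j _ => hS j).union
    (MeasurableSet.iInter fun j => (hS j).compl)

/-- `jumpSum` is known to be measurable in the path at fixed times only; a countable index set gives
joint measurability. -/
lemma measurable_jumpSum_index {Ω : Type*} [MeasurableSpace Ω] {N : Ω → Measure (ℝ × ℝ)}
    (hN : Measurable N) {K : Ω → ℕ} (hK : Measurable K) (t : ℕ → ℝ) :
    Measurable fun ω => (jumpSum (N ω) (t (K ω))).toReal := by
  have : Measurable fun p : Measure (ℝ × ℝ) × ℕ => (jumpSum p.1 (t p.2)).toReal :=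
    measurable_from_prod_countable_left fun k => (measurable_jumpSum (t k)).ennreal_toReal
  exact this.comp (hN.prodMk hK)

/-! ### Independence and first-order limits -/

/-- Fubini's theorem for a function of two independent random variables. -/
lemma integral_comp_prodMk_of_indepFun {Ω α β : Type*} [MeasurableSpace Ω] [MeasurableSpace α]
    [MeasurableSpace β] {P : Measure Ω} [IsFiniteMeasure P] {X : Ω → α} {Y : Ω → β}
    (hX : Measurable X) (hY : Measurable Y) (hXY : IndepFun X Y P) {H : α × β → ℝ}
    (hH : Measurable H) (hint : Integrable (fun ω => H (X ω, Y ω)) P) :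
    ∫ ω, H (X ω, Y ω) ∂P = ∫ ω, ∫ z, H (X ω, z) ∂(P.map Y) ∂P := by
  have hmap := (indepFun_iff_map_prod_eq_prod_map_map hX.aemeasurable hY.aemeasurable).1 hXY
  have hint' : Integrable H ((P.map X).prod (P.map Y)) := by
    rw [← hmap]
    exact (integrable_map_measure hH.aestronglyMeasurable (hX.prodMk hY).aemeasurable).2 hint
  rw [← integral_map (φ := fun ω => (X ω, Y ω)) (hX.prodMk hY).aemeasurable
    hH.aestronglyMeasurable, hmap, integral_prod _ hint']
  exact integral_map hX.aemeasurable
    (StronglyMeasurable.integral_prod_right (f := fun x y => H (x, y)) (ν := P.map Y)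
      hH.stronglyMeasurable).aestronglyMeasurable

/-- By Fubini the diagonal is null for the product law, each of its sections being a point of mass
zero for `Y`. -/
lemma ae_ne_of_indepFun {Ω : Type*} [MeasurableSpace Ω] {P : Measure Ω} [IsFiniteMeasure P]
    {X Y : Ω → ℝ} (hX : Measurable X) (hY : Measurable Y) (hXY : IndepFun X Y P)
    (hne : ∀ x, P.map Y {x} = 0) : ∀ᵐ ω ∂P, X ω ≠ Y ω := by
  have hmap := (indepFun_iff_map_prod_eq_prod_map_map hX.aemeasurable hY.aemeasurable).1 hXY
  have hdiag : MeasurableSet {p : ℝ × ℝ | p.1 = p.2} :=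
    measurableSet_eq_fun measurable_fst measurable_snd
  have h0 : ((P.map X).prod (P.map Y)) {p : ℝ × ℝ | p.1 = p.2} = 0 := by
    rw [Measure.measure_prod_null hdiag]
    refine ae_of_all _ fun x => ?_
    have : Prod.mk x ⁻¹' {p : ℝ × ℝ | p.1 = p.2} = {x} := by ext y; simp [eq_comm]
    simp only [this, hne x, Pi.zero_apply]
  rw [← hmap, Measure.map_apply (hX.prodMk hY) hdiag] at h0
  exact measure_eq_zero_iff_ae_notMem.1 h0

lemma tendsto_one_sub_exp_div (x : ℝ) {δ : ℕ → ℝ} (hδ : Filter.Tendsto δ Filter.atTop (nhds 0))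
    (hδ0 : ∀ n, 0 < δ n) :
    Filter.Tendsto (fun n => (1 - Real.exp (-(δ n * x))) / δ n) Filter.atTop (nhds x) := by
  have h1 : HasDerivAt (fun y : ℝ => -Real.exp (-(y * x))) x 0 := by
    have := (((hasDerivAt_id (0 : ℝ)).mul_const x).neg).exp.neg
    refine this.congr_deriv ?_
    simp
  rw [hasDerivAt_iff_tendsto_slope] at h1
  have hδ' : Filter.Tendsto δ Filter.atTop (nhdsWithin 0 {0}ᶜ) :=
    tendsto_nhdsWithin_iff.2 ⟨hδ, Filter.Eventually.of_forall fun n => (hδ0 n).ne'⟩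
  refine (h1.comp hδ').congr fun n => ?_
  simp only [Function.comp, slope_def_field, zero_mul, neg_zero, Real.exp_zero, sub_zero]
  ring

lemma tendsto_exp_sub_exp_div (a b : ℝ) {c : ℝ} (hc : 0 < c) {δ : ℕ → ℝ}
    (hδ : Filter.Tendsto δ Filter.atTop (nhds 0)) (hδ0 : ∀ n, 0 < δ n) :
    Filter.Tendsto (fun n => (Real.exp (-(δ n * a)) - Real.exp (-(δ n * b))) *
      (1 - Real.exp (-(δ n * c)))⁻¹) Filter.atTop (nhds ((b - a) / c)) := by
  refine (((tendsto_one_sub_exp_div b hδ hδ0).sub (tendsto_one_sub_exp_div a hδ hδ0)).div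
    (tendsto_one_sub_exp_div c hδ hδ0) hc.ne').congr fun n => ?_
  have := (hδ0 n).ne'
  simp only [Pi.div_apply]
  rw [← sub_div, div_div_div_cancel_right₀ this, div_eq_mul_inv]
  ring

lemma expMeasure_singleton (r x : ℝ) : expMeasure r {x} = 0 :=
  withDensity_absolutelyContinuous _ _ Real.volume_singleton

/-! ### The straddling interval at an independent exponential level -/

namespace HasLaplaceExponent

variable {Ω : Type*} [MeasurableSpace Ω] {P : Measure Ω} [IsProbabilityMeasure P]
  {μ : Measure ℝ} [SFinite μ] {ψ : ℝ → ℝ} {N : Ω → Measure (ℝ × ℝ)} {e : Ω → ℝ}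

lemma ae_isGenericPath (hψ : HasLaplaceExponent μ ψ) (hψ1 : 0 < ψ 1)
    (hN : IsPoissonPointProcess N (timeJumpIntensity μ) P) (he : Measurable e)
    (he_law : HasLaw e (expMeasure 1) P) (he_indep : IndepFun e N P) :
    ∀ᵐ ω ∂P, IsGenericPath (N ω) (e ω) := by
  have he0 : ∀ᵐ ω ∂P, 0 ≤ e ω := by
    refine ae_of_ae_map he.aemeasurable ?_
    rw [he_law.map_eq]
    exact gammaMeasure_ae_pos
  have hne : ∀ n k, ∀ᵐ ω ∂P, (jumpSum (N ω) (dyadicTime n k)).toReal ≠ e ω := by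
    intro n k
    have hm : Measurable fun m : Measure (ℝ × ℝ) => (jumpSum m (dyadicTime n k)).toReal :=
      (measurable_jumpSum _).ennreal_toReal
    refine ae_ne_of_indepFun (hm.comp hN.measurable) he (he_indep.symm.comp hm measurable_id) ?_
    rw [he_law.map_eq]
    exact expMeasure_singleton 1
  filter_upwards [he0, ae_all_iff.2 fun n => ae_all_iff.2 (hne n), hψ.ae_jumpSum_lt_top hN,
    hψ.ae_jumpSum_zero hN, hψ.ae_exists_lt_jumpSum hψ1 hN] with ω h0 h1 h2 h3 h4
  refine ⟨lt_of_le_of_ne h0 ?_, h2, h3, h4 _, fun n k h => h1 n k ?_⟩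
  -- Avoiding the value of the path at time `0` says exactly that `e ω ≠ 0`.
  · have := h1 0 0
    rwa [dyadicTime_zero, h3, ENNReal.toReal_zero] at this
  · rw [h, ENNReal.toReal_ofReal h0]

/-- On the crossing event `e` ranges over an interval with endpoints determined by the path.
Integrating it out against $e^{-z}$ leaves a difference of two exponentials in the path value and
the next increment, to which the subordinator transform applies. -/
lemma setIntegral_crossing (hψ : HasLaplaceExponent μ ψ) (hψ1 : 0 < ψ 1)
    (hN : IsPoissonPointProcess N (timeJumpIntensity μ) P) (he : Measurable e)
    (he_law : HasLaw e (expMeasure 1) P) (he_indep : IndepFun e N P) {q l r k : ℝ} (hq : 0 ≤ q)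
    (hl : 0 ≤ l) (hr : 0 ≤ r) (hk : 0 ≤ k) (n j : ℕ) :
    ∫ ω in {ω | crossingIndex n (N ω) (e ω) = j}, Real.exp (-(q * dyadicTime n j +
        l * (jumpSum (N ω) (dyadicTime n j)).toReal +
        r * (e ω - (jumpSum (N ω) (dyadicTime n j)).toReal) +
        k * ((jumpSum (N ω) (dyadicTime n (j + 1))).toReal -
          (jumpSum (N ω) (dyadicTime n j)).toReal))) ∂P =
      (Real.exp (-((2 ^ n)⁻¹ * ψ k)) - Real.exp (-((2 ^ n)⁻¹ * ψ (k + (1 + r))))) / (1 + r) *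
        Real.exp (-((2 ^ n)⁻¹ * (q + ψ (1 + l)))) ^ j := by
  have hr1 : 0 < 1 + r := by linarith
  have hK : Measurable fun ω => crossingIndex n (N ω) (e ω) :=
    (measurable_crossingIndex n).comp (hN.measurable.prodMk he)
  have hgd : Measurable fun m : Measure (ℝ × ℝ) => ((jumpSum m (dyadicTime n j)).toReal,
      (jumpSum m (dyadicTime n (j + 1))).toReal) :=
    ((measurable_jumpSum _).ennreal_toReal).prodMk (measurable_jumpSum _).ennreal_toReal
  set X : Ω → ℝ × ℝ := fun ω => ((jumpSum (N ω) (dyadicTime n j)).toReal,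
      (jumpSum (N ω) (dyadicTime n (j + 1))).toReal)
  have hX : Measurable X := hgd.comp hN.measurable
  have hXe : IndepFun X e P := he_indep.symm.comp hgd measurable_id
  have hXle : ∀ᵐ ω ∂P, (X ω).1 ≤ (X ω).2 := by
    filter_upwards [hψ.ae_jumpSum_lt_top hN] with ω hω
    exact ENNReal.toReal_mono (hω _).ne (jumpSum_mono _ (dyadicTime_mono n j.le_succ))
  have hX0 : ∀ ω, 0 ≤ (X ω).1 := fun ω => ENNReal.toReal_nonneg
  let H : (ℝ × ℝ) × ℝ → ℝ := {p : (ℝ × ℝ) × ℝ | p.1.1 ≤ p.2 ∧ p.2 < p.1.2}.indicator fun p =>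
    Real.exp (-(q * dyadicTime n j + l * p.1.1 + k * (p.1.2 - p.1.1))) *
      Real.exp (-(r * (p.2 - p.1.1)))
  have hHs : MeasurableSet {p : (ℝ × ℝ) × ℝ | p.1.1 ≤ p.2 ∧ p.2 < p.1.2} :=
    (measurableSet_le (f := fun p : (ℝ × ℝ) × ℝ => p.1.1) (g := fun p => p.2) (by fun_prop)
      (by fun_prop)).inter (measurableSet_lt (f := fun p : (ℝ × ℝ) × ℝ => p.2)
      (g := fun p => p.1.2) (by fun_prop) (by fun_prop))
  have hH : Measurable H := Measurable.indicator (by fun_prop) hHs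
  have hint : Integrable (fun ω => H (X ω, e ω)) P := by
    refine Integrable.of_bound (C := 1) (hH.comp (hX.prodMk he)).aestronglyMeasurable ?_
    filter_upwards [hXle] with ω hω
    by_cases h : (X ω, e ω) ∈ {p : (ℝ × ℝ) × ℝ | p.1.1 ≤ p.2 ∧ p.2 < p.1.2}
    · simp only [H]
      rw [Set.indicator_of_mem h, ← Real.exp_add, Real.norm_eq_abs, Real.abs_exp,
        Real.exp_le_one_iff, ← neg_add, neg_nonpos]
      have h1 : 0 ≤ e ω - (X ω).1 := sub_nonneg.2 h.1
      have h2 : 0 ≤ (X ω).2 - (X ω).1 := sub_nonneg.2 hω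
      have h3 := hX0 ω
      have h4 := dyadicTime_nonneg n j
      positivity
    · simp only [H]
      rw [Set.indicator_of_notMem h, norm_zero]
      exact zero_le_one
  have hKj : MeasurableSet {ω | crossingIndex n (N ω) (e ω) = j} := hK (measurableSet_singleton j)
  rw [← integral_indicator hKj]
  have hcongr : (∫ ω, {ω | crossingIndex n (N ω) (e ω) = j}.indicator (fun ω =>
      Real.exp (-(q * dyadicTime n j +
        l * (jumpSum (N ω) (dyadicTime n j)).toReal +
        r * (e ω - (jumpSum (N ω) (dyadicTime n j)).toReal) +
        k * ((jumpSum (N ω) (dyadicTime n (j + 1))).toReal -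
          (jumpSum (N ω) (dyadicTime n j)).toReal)))) ω ∂P) = ∫ ω, H (X ω, e ω) ∂P := by
    refine integral_congr_ae ?_
    filter_upwards [hψ.ae_isGenericPath hψ1 hN he he_law he_indep] with ω hω
    have hiff := hω.crossingIndex_eq_iff n j
    by_cases h : crossingIndex n (N ω) (e ω) = j
    · rw [Set.indicator_of_mem (show ω ∈ {ω | crossingIndex n (N ω) (e ω) = j} from h)]
      have h' : (X ω, e ω) ∈ {p : (ℝ × ℝ) × ℝ | p.1.1 ≤ p.2 ∧ p.2 < p.1.2} := hiff.1 h
      simp only [H]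
      rw [Set.indicator_of_mem h', ← Real.exp_add]
      congr 1; simp only [X]; ring
    · rw [Set.indicator_of_notMem (show ω ∉ {ω | crossingIndex n (N ω) (e ω) = j} from h)]
      have h' : (X ω, e ω) ∉ {p : (ℝ × ℝ) × ℝ | p.1.1 ≤ p.2 ∧ p.2 < p.1.2} :=
        fun hmem => h (hiff.2 hmem)
      simp only [H]
      rw [Set.indicator_of_notMem h']
  rw [hcongr, integral_comp_prodMk_of_indepFun hX he hXe hH hint, he_law.map_eq]
  -- The density at the left endpoint turns the rate `l` into `1 + l`; the two ends of the integral
  -- give the increment the rates `k` and `k + (1 + r)`.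
  have hinner : ∀ᵐ ω ∂P, ∫ z, H (X ω, z) ∂(expMeasure 1) =
      Real.exp (-(q * dyadicTime n j)) / (1 + r) *
        (Real.exp (-((1 + l) * (X ω).1 + k * ((X ω).2 - (X ω).1))) -
          Real.exp (-((1 + l) * (X ω).1 + (k + (1 + r)) * ((X ω).2 - (X ω).1)))) := by
    filter_upwards [hXle] with ω hω
    have h1 : ∀ z, H (X ω, z) = (Set.Ico (X ω).1 (X ω).2).indicator (fun z =>
        Real.exp (-(q * dyadicTime n j + l * (X ω).1 + k * ((X ω).2 - (X ω).1))) *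
          Real.exp (-(r * (z - (X ω).1)))) z := fun z => rfl
    simp_rw [h1]
    rw [integral_indicator measurableSet_Ico, integral_const_mul,
      setIntegral_exp_neg_expMeasure hr (hX0 ω) hω]
    have e1 : Real.exp (-((1 + l) * (X ω).1 + k * ((X ω).2 - (X ω).1))) =
        Real.exp (-(l * (X ω).1)) * Real.exp (-(X ω).1) *
          Real.exp (-(k * ((X ω).2 - (X ω).1))) := by
      rw [← Real.exp_add, ← Real.exp_add]; ring_nf
    have e2 : Real.exp (-((1 + l) * (X ω).1 + (k + (1 + r)) * ((X ω).2 - (X ω).1))) =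
        Real.exp (-(l * (X ω).1)) * Real.exp (-(X ω).1) *
          Real.exp (-(k * ((X ω).2 - (X ω).1))) *
          Real.exp (-((1 + r) * ((X ω).2 - (X ω).1))) := by
      rw [← Real.exp_add, ← Real.exp_add, ← Real.exp_add]; ring_nf
    rw [e1, e2, neg_add, neg_add, Real.exp_add, Real.exp_add]
    ring
  have hexp_int : ∀ y : ℝ, 0 ≤ y → Integrable (fun ω =>
      Real.exp (-((1 + l) * (X ω).1 + y * ((X ω).2 - (X ω).1)))) P := by
    intro y hy
    refine Integrable.of_bound (C := 1) (by fun_prop) ?_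
    filter_upwards [hXle] with ω hω
    rw [Real.norm_eq_abs, Real.abs_exp, Real.exp_le_one_iff, neg_nonpos]
    exact add_nonneg (mul_nonneg (by linarith) (hX0 ω)) (mul_nonneg hy (sub_nonneg.2 hω))
  have hk' : 0 ≤ k + (1 + r) := by linarith
  have hl' : 0 ≤ 1 + l := by linarith
  rw [integral_congr_ae hinner, integral_const_mul,
    integral_sub (hexp_int k hk) (hexp_int _ hk'),
    hψ.integral_exp_neg_jumpSum hN (dyadicTime_nonneg n j) (dyadicTime_mono n j.le_succ) hl' hk,
    hψ.integral_exp_neg_jumpSum hN (dyadicTime_nonneg n j) (dyadicTime_mono n j.le_succ) hl' hk',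
    dyadicTime_succ_sub, ← Real.exp_nat_mul, neg_add, neg_add, Real.exp_add, Real.exp_add]
  have e3 : Real.exp (j * -((2 ^ n)⁻¹ * (q + ψ (1 + l)))) =
      Real.exp (-(q * dyadicTime n j)) * Real.exp (-(dyadicTime n j * ψ (1 + l))) := by
    rw [← Real.exp_add]; congr 1; unfold dyadicTime; ring
  rw [e3]; ring

/-- The exponential of the linear form in the approximations to `(L_s, g_s, A_s, Δ_s)` given by the
`j`-th dyadic interval of level `n`. -/
noncomputable def crossingExp (q l r k : ℝ) (n : ℕ) (m : Measure (ℝ × ℝ)) (s : ℝ) (j : ℕ) : ℝ :=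
  Real.exp (-(q * dyadicTime n j + l * (jumpSum m (dyadicTime n j)).toReal +
    r * (s - (jumpSum m (dyadicTime n j)).toReal) +
    k * ((jumpSum m (dyadicTime n (j + 1))).toReal - (jumpSum m (dyadicTime n j)).toReal)))

lemma measurable_crossingExp (hN : Measurable N) (he : Measurable e) (q l r k : ℝ) (n : ℕ) :
    Measurable fun ω => crossingExp q l r k n (N ω) (e ω) (crossingIndex n (N ω) (e ω)) := by
  have hK : Measurable fun ω => crossingIndex n (N ω) (e ω) :=
    (measurable_crossingIndex n).comp (hN.prodMk he)
  have h1 := measurable_jumpSum_index hN hK fun j => dyadicTime n j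
  have h2 := measurable_jumpSum_index hN hK fun j => dyadicTime n (j + 1)
  have h3 : Measurable fun ω => dyadicTime n (crossingIndex n (N ω) (e ω)) :=
    (measurable_from_top (f := dyadicTime n)).comp hK
  unfold crossingExp
  fun_prop

lemma norm_crossingExp_le_one {q l r k : ℝ} (hq : 0 ≤ q) (hl : 0 ≤ l) (hr : 0 ≤ r) (hk : 0 ≤ k)
    {m : Measure (ℝ × ℝ)} {s : ℝ} (h : IsGenericPath m s) (n : ℕ) :
    ‖crossingExp q l r k n m s (crossingIndex n m s)‖ ≤ 1 := by
  obtain ⟨h1, h2⟩ := (h.crossingIndex_eq_iff n _).1 rfl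
  rw [crossingExp, Real.norm_eq_abs, Real.abs_exp, Real.exp_le_one_iff, neg_nonpos]
  have h3 := sub_nonneg.2 h1
  have h4 := sub_nonneg.2 (h1.trans h2.le)
  have h5 := dyadicTime_nonneg n (crossingIndex n m s)
  positivity

/-- The crossing events for different `j` partition the space, and their contributions form a
geometric series; `hc` makes its ratio less than one. -/
lemma integral_crossingExp (hψ : HasLaplaceExponent μ ψ) (hψ1 : 0 < ψ 1)
    (hN : IsPoissonPointProcess N (timeJumpIntensity μ) P) (he : Measurable e)
    (he_law : HasLaw e (expMeasure 1) P) (he_indep : IndepFun e N P) {q l r k : ℝ} (hq : 0 ≤ q)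
    (hl : 0 ≤ l) (hr : 0 ≤ r) (hk : 0 ≤ k) (hc : 0 < q + ψ (1 + l)) (n : ℕ) :
    ∫ ω, crossingExp q l r k n (N ω) (e ω) (crossingIndex n (N ω) (e ω)) ∂P =
      (Real.exp (-((2 ^ n)⁻¹ * ψ k)) - Real.exp (-((2 ^ n)⁻¹ * ψ (k + (1 + r))))) / (1 + r) *
        (1 - Real.exp (-((2 ^ n)⁻¹ * (q + ψ (1 + l)))))⁻¹ := by
  have hK : Measurable fun ω => crossingIndex n (N ω) (e ω) :=
    (measurable_crossingIndex n).comp (hN.measurable.prodMk he)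
  have hint : Integrable
      (fun ω => crossingExp q l r k n (N ω) (e ω) (crossingIndex n (N ω) (e ω))) P := by
    refine Integrable.of_bound (C := 1)
      (measurable_crossingExp hN.measurable he q l r k n).aestronglyMeasurable ?_
    filter_upwards [hψ.ae_isGenericPath hψ1 hN he he_law he_indep] with ω hω
    exact norm_crossingExp_le_one hq hl hr hk hω n
  have hKj : ∀ j, MeasurableSet {ω | crossingIndex n (N ω) (e ω) = j} :=
    fun j => hK (measurableSet_singleton j)
  have hsum := hasSum_integral_iUnion hKj (fun i j hij => Set.disjoint_left.2
    fun ω (hi : crossingIndex n (N ω) (e ω) = i) (hj : crossingIndex n (N ω) (e ω) = j) =>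
      hij (hi.symm.trans hj)) hint.integrableOn
  have huniv : ⋃ j, {ω | crossingIndex n (N ω) (e ω) = j} = Set.univ :=
    Set.eq_univ_of_forall fun ω => Set.mem_iUnion.2 ⟨_, rfl⟩
  rw [huniv, Measure.restrict_univ] at hsum
  refine hsum.unique ?_
  have hgeo := (hasSum_geometric_of_lt_one (Real.exp_nonneg (-((2 ^ n)⁻¹ * (q + ψ (1 + l)))))
    (Real.exp_lt_one_iff.2 (neg_lt_zero.2 (by positivity)))).mul_left
    ((Real.exp (-((2 ^ n)⁻¹ * ψ k)) - Real.exp (-((2 ^ n)⁻¹ * ψ (k + (1 + r))))) / (1 + r))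
  refine (congrArg (HasSum · _) (funext fun j => ?_)).mpr hgeo
  rw [← hψ.setIntegral_crossing hψ1 hN he he_law he_indep hq hl hr hk n j]
  refine setIntegral_congr_fun (hKj j) fun ω hω => ?_
  have hω : crossingIndex n (N ω) (e ω) = j := hω
  simp only [hω, crossingExp]

/-- The joint Laplace transform of `(L_e, g_e, A_e, Δ_e)`. -/
lemma integral_exp_neg_straddling (hψ : HasLaplaceExponent μ ψ) (hψ1 : 0 < ψ 1)
    (hN : IsPoissonPointProcess N (timeJumpIntensity μ) P) (he : Measurable e)
    (he_law : HasLaw e (expMeasure 1) P) (he_indep : IndepFun e N P) {q l r k : ℝ} (hq : 0 ≤ q)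
    (hl : 0 ≤ l) (hr : 0 ≤ r) (hk : 0 ≤ k) (hc : 0 < q + ψ (1 + l)) :
    ∫ ω, Real.exp (-(q * inverseTime (N ω) (e ω) + l * leftEnd (N ω) (e ω) +
        r * (e ω - leftEnd (N ω) (e ω)) +
        k * (rightEnd (N ω) (e ω) - leftEnd (N ω) (e ω)))) ∂P =
      (ψ (k + (1 + r)) - ψ k) / (1 + r) * (q + ψ (1 + l))⁻¹ := by
  have hgen := hψ.ae_isGenericPath hψ1 hN he he_law he_indep
  have h1 := tendsto_integral_of_dominated_convergence (μ := P)
    (F := fun n ω => crossingExp q l r k n (N ω) (e ω) (crossingIndex n (N ω) (e ω)))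
    (f := fun ω => Real.exp (-(q * inverseTime (N ω) (e ω) + l * leftEnd (N ω) (e ω) +
        r * (e ω - leftEnd (N ω) (e ω)) +
        k * (rightEnd (N ω) (e ω) - leftEnd (N ω) (e ω))))) (fun _ => 1)
    (fun n => (measurable_crossingExp hN.measurable he q l r k n).aestronglyMeasurable)
    (integrable_const _)
    (fun n => by
      filter_upwards [hgen] with ω hω
      exact norm_crossingExp_le_one hq hl hr hk hω n)
    (by
      filter_upwards [hgen] with ω hω
      refine (Real.continuous_exp.tendsto _).comp (Filter.Tendsto.neg ?_)
      exact (((hω.tendsto_dyadicTime.const_mul q).add (hω.tendsto_leftEnd.const_mul l)).add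
        ((hω.tendsto_leftEnd.const_sub (e ω)).const_mul r)).add
          ((hω.tendsto_rightEnd.sub hω.tendsto_leftEnd).const_mul k))
  refine tendsto_nhds_unique h1 ?_
  simp_rw [hψ.integral_crossingExp hψ1 hN he he_law he_indep hq hl hr hk hc]
  -- Numerator and denominator are both of order $2^{-n}$, so the limit is the quotient of their
  -- derivatives at `0`.
  have h2 := (tendsto_exp_sub_exp_div (ψ k) (ψ (k + (1 + r))) hc tendsto_inv_two_pow
    (fun n => by positivity)).div_const (1 + r)
  convert h2 using 2
  · ring
  · ring

/-- All three are almost sure limits of measurable dyadic approximations. -/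
lemma aemeasurable_inverseTime (hψ : HasLaplaceExponent μ ψ) (hψ1 : 0 < ψ 1)
    (hN : IsPoissonPointProcess N (timeJumpIntensity μ) P) (he : Measurable e)
    (he_law : HasLaw e (expMeasure 1) P) (he_indep : IndepFun e N P) :
    AEMeasurable (fun ω => inverseTime (N ω) (e ω)) P ∧
      AEMeasurable (fun ω => leftEnd (N ω) (e ω)) P ∧
      AEMeasurable (fun ω => rightEnd (N ω) (e ω)) P := by
  have hgen := hψ.ae_isGenericPath hψ1 hN he he_law he_indep
  have hK : ∀ n, Measurable fun ω => crossingIndex n (N ω) (e ω) := fun n =>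
    (measurable_crossingIndex n).comp (hN.measurable.prodMk he)
  refine ⟨?_, ?_, ?_⟩
  · exact aemeasurable_of_tendsto_metrizable_ae' (fun n =>
      ((measurable_from_top (f := dyadicTime n)).comp (hK n)).aemeasurable)
      (hgen.mono fun ω hω => hω.tendsto_dyadicTime)
  · exact aemeasurable_of_tendsto_metrizable_ae' (fun n =>
      (measurable_jumpSum_index hN.measurable (hK n) fun j => dyadicTime n j).aemeasurable)
      (hgen.mono fun ω hω => hω.tendsto_leftEnd)
  · exact aemeasurable_of_tendsto_metrizable_ae' (fun n =>
      (measurable_jumpSum_index hN.measurable (hK n) fun j => dyadicTime n (j + 1)).aemeasurable)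
      (hgen.mono fun ω hω => hω.tendsto_rightEnd)

end HasLaplaceExponent

/-! ### A subordinator at an independent exponential time -/

/-- The dyadic approximation of `t` from the right. -/
noncomputable def dyadicCeil (n : ℕ) (t : ℝ) : ℝ := dyadicTime n (⌊t * 2 ^ n⌋₊ + 1)

lemma dyadicCeil_nonneg (n : ℕ) (t : ℝ) : 0 ≤ dyadicCeil n t := dyadicTime_nonneg _ _

lemma measurable_floor_mul_two_pow (n : ℕ) : Measurable fun t : ℝ => ⌊t * 2 ^ n⌋₊ :=
  Nat.measurable_floor.comp (by fun_prop)

lemma measurable_dyadicCeil (n : ℕ) : Measurable (dyadicCeil n) :=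
  (measurable_from_top (f := fun j : ℕ => dyadicTime n (j + 1))).comp
    (measurable_floor_mul_two_pow n)

lemma lt_dyadicCeil (n : ℕ) (t : ℝ) : t < dyadicCeil n t := by
  rw [dyadicCeil, dyadicTime, lt_div_iff₀ (by positivity)]
  push_cast
  exact Nat.lt_floor_add_one _

lemma dyadicCeil_le (n : ℕ) {t : ℝ} (ht : 0 ≤ t) : dyadicCeil n t ≤ t + (2 ^ n)⁻¹ := by
  have h := Nat.floor_le (mul_nonneg ht (by positivity : (0 : ℝ) ≤ 2 ^ n))
  have h2 : (0 : ℝ) < 2 ^ n := by positivity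
  rw [dyadicCeil, dyadicTime, div_le_iff₀ h2, add_mul, inv_mul_cancel₀ h2.ne']
  push_cast
  linarith

lemma tendsto_dyadicCeil {t : ℝ} (ht : 0 ≤ t) :
    Filter.Tendsto (fun n => dyadicCeil n t) Filter.atTop (nhds t) := by
  have h1 := tendsto_inv_two_pow.const_add t
  rw [add_zero] at h1
  exact tendsto_of_tendsto_of_tendsto_of_le_of_le tendsto_const_nhds h1
    (fun n => (lt_dyadicCeil n t).le) fun n => dyadicCeil_le n ht

lemma tendsto_jumpSum_dyadicCeil {m : Measure (ℝ × ℝ)} (hm : ∀ t, jumpSum m t < ∞) {t : ℝ}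
    (ht : 0 ≤ t) : Filter.Tendsto (fun n => (jumpSum m (dyadicCeil n t)).toReal) Filter.atTop
      (nhds (jumpSum m t).toReal) := by
  have hlim : Filter.Tendsto (fun n => dyadicCeil n t) Filter.atTop (nhdsWithin t (Set.Ici t)) :=
    tendsto_nhdsWithin_iff.2 ⟨tendsto_dyadicCeil ht,
      Filter.Eventually.of_forall fun n => (lt_dyadicCeil n t).le⟩
  exact (ENNReal.tendsto_toReal (hm t).ne).comp
    ((continuousWithinAt_jumpSum hm t).tendsto.comp hlim)

lemma measurable_jumpSum_dyadicCeil (n : ℕ) :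
    Measurable fun p : ℝ × Measure (ℝ × ℝ) => (jumpSum p.2 (dyadicCeil n p.1)).toReal :=
  measurable_jumpSum_index measurable_snd
    ((measurable_floor_mul_two_pow n).comp measurable_fst) fun j => dyadicTime n (j + 1)

namespace HasLaplaceExponent

variable {Ω : Type*} [MeasurableSpace Ω] {P : Measure Ω} [IsProbabilityMeasure P]
  {μ : Measure ℝ} [SFinite μ] {ψ : ℝ → ℝ} {N : Ω → Measure (ℝ × ℝ)} {T : Ω → ℝ}

lemma aemeasurable_jumpSum_time (hψ : HasLaplaceExponent μ ψ)
    (hN : IsPoissonPointProcess N (timeJumpIntensity μ) P) (hT : Measurable T)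
    (hT0 : ∀ᵐ ω ∂P, 0 ≤ T ω) : AEMeasurable (fun ω => (jumpSum (N ω) (T ω)).toReal) P := by
  refine aemeasurable_of_tendsto_metrizable_ae' (fun n =>
    ((measurable_jumpSum_dyadicCeil n).comp (hT.prodMk hN.measurable)).aemeasurable) ?_
  filter_upwards [hψ.ae_jumpSum_lt_top hN, hT0] with ω h1 h2
  exact tendsto_jumpSum_dyadicCeil h1 h2

/-- Given `T`, the dyadic time is deterministic, so the path contributes $e^{-t\psi(l)}$ and `q` is
shifted to `q + ψ l`. -/
lemma integral_exp_neg_dyadicCeil (hψ : HasLaplaceExponent μ ψ)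
    (hN : IsPoissonPointProcess N (timeJumpIntensity μ) P) (hT : Measurable T)
    (hTN : IndepFun T N P) {q l : ℝ} (hq : 0 ≤ q) (hl : 0 ≤ l) (n : ℕ) :
    ∫ ω, Real.exp (-(q * dyadicCeil n (T ω) +
        l * (jumpSum (N ω) (dyadicCeil n (T ω))).toReal)) ∂P =
      ∫ ω, Real.exp (-((q + ψ l) * dyadicCeil n (T ω))) ∂P := by
  let H : ℝ × Measure (ℝ × ℝ) → ℝ := fun p => Real.exp (-(q * dyadicCeil n p.1 +
        l * (jumpSum p.2 (dyadicCeil n p.1)).toReal))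
  have hH : Measurable H := by
    have h1 := measurable_jumpSum_dyadicCeil n
    have h2 := measurable_dyadicCeil n
    simp only [H]
    fun_prop
  have hint : Integrable (fun ω => H (T ω, N ω)) P := by
    refine Integrable.of_bound (C := 1) (hH.comp (hT.prodMk hN.measurable)).aestronglyMeasurable
      (ae_of_all _ fun ω => ?_)
    rw [Real.norm_eq_abs, Real.abs_exp, Real.exp_le_one_iff, neg_nonpos]
    have := dyadicCeil_nonneg n (T ω)
    positivity
  refine (integral_comp_prodMk_of_indepFun hT hN.measurable hTN hH hint).trans ?_
  congr 1
  ext ω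
  have ht := dyadicCeil_nonneg n (T ω)
  rw [integral_map (φ := N) hN.measurable.aemeasurable
    (f := fun m => H (T ω, m)) (hH.comp measurable_prodMk_left).aestronglyMeasurable]
  have h := hψ.integral_exp_neg_jumpSum hN ht le_rfl hl le_rfl
  simp only [zero_mul, add_zero, sub_self] at h
  simp only [H, neg_add, Real.exp_add]
  rw [integral_const_mul, h, ← Real.exp_add]
  ring_nf

/-- The joint Laplace transform of an independent exponential time, the subordinator at that time
and a further independent variable. -/
lemma integral_exp_neg_time_mul (hψ : HasLaplaceExponent μ ψ)
    (hN : IsPoissonPointProcess N (timeJumpIntensity μ) P) (hT : Measurable T)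
    (hT_law : HasLaw T (expMeasure 1) P) (hTN : IndepFun T N P) {β : Type*} [MeasurableSpace β]
    {Z : Ω → β} (hind : IndepFun (fun ω => (T ω, N ω)) Z P) {V : β → ℝ} (hZ : Measurable Z)
    (hV : Measurable V) (hV1 : ∀ᵐ ω ∂P, ‖V (Z ω)‖ ≤ 1) {q l : ℝ} (hq : 0 ≤ q) (hl : 0 ≤ l) :
    ∫ ω, Real.exp (-(q * T ω + l * (jumpSum (N ω) (T ω)).toReal)) * V (Z ω) ∂P =
      (1 + (q + ψ l))⁻¹ * ∫ ω, V (Z ω) ∂P := by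
  have hT0 : ∀ᵐ ω ∂P, 0 ≤ T ω := by
    refine ae_of_ae_map hT.aemeasurable ?_
    rw [hT_law.map_eq]
    exact gammaMeasure_ae_pos
  have hψl := hψ.nonneg l hl
  let W : ℕ → ℝ × Measure (ℝ × ℝ) → ℝ := fun n p => Real.exp (-(q * dyadicCeil n p.1 +
        l * (jumpSum p.2 (dyadicCeil n p.1)).toReal))
  have hW : ∀ n, Measurable (W n) := by
    intro n
    have h1 := measurable_jumpSum_dyadicCeil n
    have h2 := measurable_dyadicCeil n
    simp only [W]
    fun_prop
  have hTN' : Measurable fun ω => (T ω, N ω) := hT.prodMk hN.measurable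
  have hWn : ∀ n p, ‖W n p‖ ≤ 1 := by
    intro n p
    rw [Real.norm_eq_abs, Real.abs_exp, Real.exp_le_one_iff, neg_nonpos]
    have := dyadicCeil_nonneg n p.1
    positivity
  -- The dyadic times decrease the question to countably many values of time; approximation from the
  -- right matches right continuity of the path.
  have h1 : Filter.Tendsto (fun n => ∫ ω, W n (T ω, N ω) * V (Z ω) ∂P) Filter.atTop
      (nhds (∫ ω, Real.exp (-(q * T ω + l * (jumpSum (N ω) (T ω)).toReal)) * V (Z ω) ∂P)) := by
    refine tendsto_integral_of_dominated_convergence (fun _ => 1) (fun n =>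
      (((hW n).comp hTN').mul (hV.comp hZ)).aestronglyMeasurable) (integrable_const _)
      (fun n => ?_) ?_
    · filter_upwards [hV1] with ω hω
      rw [norm_mul]
      exact mul_le_one₀ (hWn n _) (norm_nonneg _) hω
    · filter_upwards [hψ.ae_jumpSum_lt_top hN, hT0] with ω hω1 hω2
      refine Filter.Tendsto.mul_const _ ((Real.continuous_exp.tendsto _).comp ?_)
      exact (((tendsto_dyadicCeil hω2).const_mul q).add
        ((tendsto_jumpSum_dyadicCeil hω1 hω2).const_mul l)).neg
  have h2 : ∀ n, ∫ ω, W n (T ω, N ω) * V (Z ω) ∂P =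
      (∫ ω, Real.exp (-((q + ψ l) * dyadicCeil n (T ω))) ∂P) * ∫ ω, V (Z ω) ∂P := by
    intro n
    rw [← hψ.integral_exp_neg_dyadicCeil hN hT hTN hq hl n]
    exact (hind.comp (hW n) hV).integral_fun_mul_eq_mul_integral
      ((hW n).comp hTN').aestronglyMeasurable (hV.comp hZ).aestronglyMeasurable
  simp_rw [h2] at h1
  refine tendsto_nhds_unique h1 (Filter.Tendsto.mul_const _ ?_)
  rw [← integral_exp_neg_mul_expMeasure (add_nonneg hq hψl), ← hT_law.map_eq,
    integral_map hT.aemeasurable (by fun_prop)]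
  refine tendsto_integral_of_dominated_convergence (fun _ => 1) (fun n => ?_)
    (integrable_const _) (fun n => ae_of_all _ fun ω => ?_) ?_
  · have := measurable_dyadicCeil n
    exact (by fun_prop : Measurable fun ω =>
      Real.exp (-((q + ψ l) * dyadicCeil n (T ω)))).aestronglyMeasurable
  · rw [Real.norm_eq_abs, Real.abs_exp, Real.exp_le_one_iff, neg_nonpos]
    have := dyadicCeil_nonneg n (T ω)
    positivity
  · filter_upwards [hT0] with ω hω
    exact (Real.continuous_exp.tendsto _).comp (((tendsto_dyadicCeil hω).const_mul _).neg)

end HasLaplaceExponent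

/-! ### The gamma–uniform pair -/

section Straddling

variable {Ω : Type*} [MeasurableSpace Ω] {P : Measure Ω} {G U : Ω → ℝ} {α : ℝ}

lemma ae_mem_Ioo_of_isUniform (hU : Measurable U)
    (hU_law : pdf.IsUniform U (Set.Ioo 0 1) P volume) : ∀ᵐ ω ∂P, U ω ∈ Set.Ioo (0 : ℝ) 1 := by
  refine ae_of_ae_map (p := fun u => u ∈ Set.Ioo (0 : ℝ) 1) hU.aemeasurable ?_
  rw [hU_law]
  exact ae_cond_mem measurableSet_Ioo

lemma ae_nonneg_of_gamma (hG : Measurable G) {a r : ℝ} (hG_law : HasLaw G (gammaMeasure a r) P) :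
    ∀ᵐ ω ∂P, 0 ≤ G ω := by
  refine ae_of_ae_map hG.aemeasurable ?_
  rw [hG_law.map_eq]
  exact gammaMeasure_ae_pos

/-- The joint Laplace transform of `(G, G U^{-1/α})`. -/
lemma integral_exp_neg_gamma_uniform [IsProbabilityMeasure P] (hα0 : 0 < α) (hα1 : α < 1) (hG : Measurable G)
    (hG_law : HasLaw G (gammaMeasure (1 - α) 1) P) (hU : Measurable U)
    (hU_law : pdf.IsUniform U (Set.Ioo 0 1) P volume) (hGU : IndepFun G U P) {r k : ℝ}
    (hr : 0 ≤ r) (hk : 0 ≤ k) :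
    ∫ ω, Real.exp (-(r * G ω + k * (G ω * U ω ^ (-(1 / α))))) ∂P =
      ((k + (1 + r)) ^ α - k ^ α) / (1 + r) := by
  have hUpos := ae_mem_Ioo_of_isUniform hU hU_law
  have hG0 := ae_nonneg_of_gamma hG hG_law
  let H : ℝ × ℝ → ℝ := fun p => Real.exp (-(r * p.2 + k * (p.2 * p.1 ^ (-(1 / α)))))
  have hH : Measurable H := by simp only [H]; fun_prop
  have hint : Integrable (fun ω => H (U ω, G ω)) P := by
    refine Integrable.of_bound (C := 1) (hH.comp (hU.prodMk hG)).aestronglyMeasurable ?_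
    filter_upwards [hUpos, hG0] with ω h1 h2
    rw [Real.norm_eq_abs, Real.abs_exp, Real.exp_le_one_iff, neg_nonpos]
    have := h1.1
    positivity
  refine (integral_comp_prodMk_of_indepFun hU hG hGU.symm hH hint).trans ?_
  rw [hG_law.map_eq]
  -- With `U` fixed the exponent is linear in `G`, with coefficient $r+kU^{-1/\alpha}$, and the
  -- gamma transform applies.
  have hinner : ∀ᵐ ω ∂P, ∫ z, H (U ω, z) ∂(gammaMeasure (1 - α) 1) =
      ((1 + r) + k * U ω ^ (-(1 / α))) ^ (-(1 - α)) := by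
    filter_upwards [hUpos] with ω hω
    have hu := hω.1
    have h := integral_exp_neg_mul_gammaMeasure (by linarith : 0 < 1 - α)
      (by positivity : 0 ≤ r + k * U ω ^ (-(1 / α)))
    rw [← add_assoc] at h
    rw [← h]
    congr 1
    ext z
    simp only [H]
    ring_nf
  rw [integral_congr_ae hinner, ← integral_map (φ := U)
    (f := fun u => ((1 + r) + k * u ^ (-(1 / α))) ^ (-(1 - α))) hU.aemeasurable
    (by fun_prop : Measurable fun u : ℝ =>
      ((1 + r) + k * u ^ (-(1 / α))) ^ (-(1 - α))).aestronglyMeasurable, hU_law, ProbabilityTheory.cond,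
    integral_smul_measure, Real.volume_Ioo, integral_add_mul_rpow_rpow hα0 (by linarith) hk]
  simp [add_comm]

end Straddling

/-! ### Comparison of the two transforms -/

theorem proposition3p3
    (α : ℝ) (hα0 : 0 < α) (hα1 : α < 1)
    -- the stable subordinator, given by its jumps, and an independent exponential time
    {Ω : Type*} [MeasurableSpace Ω] (P : Measure Ω) [IsProbabilityMeasure P]
    (N : Ω → Measure (ℝ × ℝ))
    (hN : IsPoissonPointProcess N (timeJumpIntensity (stableLevy α)) P)
    (e : Ω → ℝ) (he : Measurable e) (he_law : HasLaw e (expMeasure 1) P)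
    (he_indep : IndepFun e N P)
    -- the independent ingredients of the right-hand side
    {Ω' : Type*} [MeasurableSpace Ω'] (P' : Measure Ω') [IsProbabilityMeasure P']
    (G₁ U T : Ω' → ℝ) (Nv : Ω' → Measure (ℝ × ℝ))
    (hG₁ : Measurable G₁) (hG₁_law : HasLaw G₁ (gammaMeasure (1 - α) 1) P')
    (hU : Measurable U) (hU_law : pdf.IsUniform U (Set.Ioo 0 1) P' volume)
    (hT : Measurable T) (hT_law : HasLaw T (expMeasure 1) P')
    (hNv : IsPoissonPointProcess Nv (timeJumpIntensity (thinnedLevy α)) P')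
    (h_indep : iIndep ![MeasurableSpace.comap G₁ inferInstance,
      MeasurableSpace.comap U inferInstance, MeasurableSpace.comap T inferInstance,
      MeasurableSpace.comap Nv inferInstance] P')
    (G₀ : Ω' → ℝ) (hG₀ : ∀ ω, G₀ ω = (jumpSum (Nv ω) (T ω)).toReal) :
    -- all the objects are almost surely well defined
    (∀ᵐ ω ∂P, (∀ t : ℝ, jumpSum (N ω) t < ∞) ∧
      ∀ s : ℝ, ∃ t : ℝ, 0 ≤ t ∧ ENNReal.ofReal s < jumpSum (N ω) t) ∧
    (∀ᵐ ω ∂P', jumpSum (Nv ω) (T ω) < ∞) ∧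
    HasLaw G₀ (gammaMeasure α 1) P' ∧
    IdentDistrib
      (fun ω => ![e ω, inverseTime (N ω) (e ω), overshoot (N ω) (e ω), undershoot (N ω) (e ω),
        leftEnd (N ω) (e ω), rightEnd (N ω) (e ω), straddlingLength (N ω) (e ω)])
      (fun ω => ![G₀ ω + G₁ ω, T ω, G₁ ω * (U ω ^ (-(1 / α)) - 1), G₁ ω, G₀ ω,
        G₀ ω + G₁ ω * U ω ^ (-(1 / α)), G₁ ω * U ω ^ (-(1 / α))])
      P P' := by
  have hs := hasLaplaceExponent_stableLevy hα0 hα1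
  have ht := hasLaplaceExponent_thinnedLevy hα0 hα1
  have hs1 : (0 : ℝ) < 1 ^ α := by rw [Real.one_rpow]; exact one_pos
  have hgen := hs.ae_isGenericPath hs1 hN he he_law he_indep
  have hT0 : ∀ᵐ ω ∂P', 0 ≤ T ω := ae_nonneg_of_gamma hT hT_law
  have hG₁0 := ae_nonneg_of_gamma hG₁ hG₁_law
  have hU0 := ae_mem_Ioo_of_isUniform hU hU_law
  have hG₁U : IndepFun G₁ U P' := h_indep.indep (i := 0) (j := 1) (by decide)
  have hTN : IndepFun T Nv P' := h_indep.indep (i := 2) (j := 3) (by decide)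
  have hpair : IndepFun (fun ω => (T ω, Nv ω)) (fun ω => (G₁ ω, U ω)) P' := by
    have h := indep_iSup_of_disjoint (S := {2, 3}) (T := {0, 1}) (fun i => by
      fin_cases i
      · exact hG₁.comap_le
      · exact hU.comap_le
      · exact hT.comap_le
      · exact hNv.measurable.comap_le) h_indep (by simp)
    rw [iSup_pair, iSup_pair] at h
    rw [IndepFun_iff_Indep]
    refine indep_of_indep_of_le_left (indep_of_indep_of_le_right h ?_) ?_
    · exact (MeasurableSpace.comap_prodMk G₁ U).le
    · exact (MeasurableSpace.comap_prodMk T Nv).le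
  -- The two factors come from the independent pairs `(T, Nv)` and `(G₁, U)`; the exponential time
  -- contributes $1+q+((1+l)^\alpha-1)=q+(1+l)^\alpha$.
  have hlap : ∀ q l r k : ℝ, 0 ≤ q → 0 ≤ l → 0 ≤ r → 0 ≤ k →
      ∫ ω, Real.exp (-(q * T ω + l * G₀ ω + r * G₁ ω + k * (G₁ ω * U ω ^ (-(1 / α))))) ∂P' =
        (q + (1 + l) ^ α)⁻¹ * (((k + (1 + r)) ^ α - k ^ α) / (1 + r)) := by
    intro q l r k hq hl hr hk
    have hV : Measurable fun p : ℝ × ℝ =>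
        Real.exp (-(r * p.1 + k * (p.1 * p.2 ^ (-(1 / α))))) := by fun_prop
    have h := ht.integral_exp_neg_time_mul hNv hT hT_law hTN hpair (hG₁.prodMk hU) hV (by
      filter_upwards [hG₁0, hU0] with ω h1 h2
      rw [Real.norm_eq_abs, Real.abs_exp, Real.exp_le_one_iff, neg_nonpos]
      have := h2.1
      positivity) hq hl
    rw [integral_exp_neg_gamma_uniform hα0 hα1 hG₁ hG₁_law hU hU_law hG₁U hr hk,
      show 1 + (q + ((1 + l) ^ α - 1)) = q + (1 + l) ^ α by ring] at h
    rw [← h]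
    congr 1
    ext ω
    rw [← Real.exp_add, hG₀]
    ring_nf
  have hG₀m : AEMeasurable G₀ P' := by
    rw [funext hG₀]
    exact ht.aemeasurable_jumpSum_time hNv hT hT0
  have hG₀0 : ∀ ω, 0 ≤ G₀ ω := fun ω => hG₀ ω ▸ ENNReal.toReal_nonneg
  refine ⟨?_, ?_, ?_, ?_⟩
  · filter_upwards [hs.ae_jumpSum_lt_top hN, hs.ae_exists_lt_jumpSum hs1 hN] with ω h1 h2
    exact ⟨h1, h2⟩
  · filter_upwards [ht.ae_jumpSum_lt_top hNv] with ω h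
    exact h _
  · have := isProbabilityMeasure_gammaMeasure hα0 one_pos
    have h : IdentDistrib (fun ω (_ : Fin 1) => G₀ ω) (fun x (_ : Fin 1) => x) P'
        (gammaMeasure α 1) := by
      refine identDistrib_of_laplace (by fun_prop) (by fun_prop)
        (ae_of_all _ fun ω _ => hG₀0 ω) (gammaMeasure_ae_pos.mono fun x hx _ => hx) fun c => ?_
      have hc : (0 : ℝ) ≤ c 0 := (c 0).cast_nonneg
      -- With `q = r = k = 0` the second factor is $1$, leaving $(1+l)^{-\alpha}$, the gamma
      -- transform.
      have h1 := hlap 0 (c 0) 0 0 le_rfl hc le_rfl le_rfl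
      simp only [Fin.sum_univ_one, integral_exp_neg_mul_gammaMeasure hα0 hc]
      simp only [zero_mul, zero_add, add_zero, Real.one_rpow, Real.zero_rpow hα0.ne', sub_zero,
        div_one, mul_one] at h1
      rw [h1, Real.rpow_neg (by linarith)]
    have h' := h.comp (measurable_pi_apply (0 : Fin 1))
    exact ⟨hG₀m, h'.map_eq.trans Measure.map_id⟩
  · obtain ⟨hLm, hgm, hdm⟩ := hs.aemeasurable_inverseTime hs1 hN he he_law he_indep
    have hbase : IdentDistrib
        (fun ω => ![inverseTime (N ω) (e ω), leftEnd (N ω) (e ω), e ω - leftEnd (N ω) (e ω),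
          rightEnd (N ω) (e ω) - leftEnd (N ω) (e ω)])
        (fun ω => ![T ω, G₀ ω, G₁ ω, G₁ ω * U ω ^ (-(1 / α))]) P P' := by
      refine identDistrib_of_laplace ?_ ?_ ?_ ?_ fun c => ?_
      · refine aemeasurable_pi_lambda _ fun i => ?_
        fin_cases i
        · exact hLm
        · exact hgm
        · exact he.aemeasurable.sub hgm
        · exact hdm.sub hgm
      · refine aemeasurable_pi_lambda _ fun i => ?_
        fin_cases i
        · exact hT.aemeasurable
        · exact hG₀m
        · exact hG₁.aemeasurable
        · exact (hG₁.mul (hU.pow_const _)).aemeasurable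
      · filter_upwards [hgen] with ω hω i
        fin_cases i
        · exact hω.inverseTime_pos.le
        · exact ENNReal.toReal_nonneg
        · exact sub_nonneg.2 hω.leftEnd_le
        · exact sub_nonneg.2 (hω.leftEnd_le.trans hω.le_rightEnd)
      · filter_upwards [hT0, hG₁0, hU0] with ω h1 h2 h3 i
        fin_cases i
        · exact h1
        · exact hG₀0 ω
        · exact h2
        · exact mul_nonneg h2 (Real.rpow_nonneg h3.1.le _)
      · have h1 := hs.integral_exp_neg_straddling hs1 hN he he_law he_indep (c 0).cast_nonneg
          (c 1).cast_nonneg (c 2).cast_nonneg (c 3).cast_nonneg (by positivity)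
        have h2 := hlap _ _ _ _ (c 0).cast_nonneg (c 1).cast_nonneg (c 2).cast_nonneg
          (c 3).cast_nonneg
        rw [mul_comm, ← h1] at h2
        simp only [Fin.sum_univ_four]
        exact h2.symm
    -- `F` recovers the seven coordinates from $(L,g,A,\Delta)$: $e=g+A$, $B=\Delta-A$ and
    -- $d=g+\Delta$.
    let F : (Fin 4 → ℝ) → Fin 7 → ℝ := fun v =>
      ![v 1 + v 2, v 0, v 3 - v 2, v 2, v 1, v 1 + v 3, v 3]
    have hF : Measurable F := by
      refine measurable_pi_lambda _ fun i => ?_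
      fin_cases i <;> simp only [F] <;> dsimp <;> fun_prop
    convert hbase.comp hF using 1
    · ext ω i
      fin_cases i <;> simp [F, overshoot, undershoot, straddlingLength]
    · ext ω i
      fin_cases i <;> simp [F]
      ring
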